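/- Let $k$ be a field, let $Q$ be a finite quiver, and let $A = kQ/I$ be a monomial algebra; that is, $kQ$ is the path algebra of $Q$, $J$ is its ideal generated by the arrows, and $I$ is a two-sided ideal generated by paths with $J^m \subseteq I \subseteq J^2$ for some $m \ge 2$. Paths are composed from left to right, and $\operatorname{mod} A$ denotes the category of finitely generated right $A$-modules. Let $K_0(A)$ be the abelian group generated by the symbols $[M]$, $M \in \operatorname{mod} A$, modulo the relations $[M] = [M'] + [M'']$ whenever $M \cong M' \oplus M''$ and $[P] = 0$ for $P$ projective. Let $\bar\Omega : K_0(A) \to K_0(A)$ be the endomorphism induced by the syzygy, $\bar\Omega[M] = [\Omega M]$, where $\Omega M$ is the kernel of the projective cover of $M$. For $M \in \operatorname{mod} A$ let $\langle \operatorname{add} M\rangle \subseteq K_0(A)$ be the subgroup generated by the classes of the indecomposable direct summands of $M$, and put $$\phi(M) = \min\{\, l \ge 0 : \bar\Omega \text{ is injective on } \bar\Omega^{\,l+s}(\langle \operatorname{add} M\rangle) \text{ for all } s \ge 0 \,\}, \qquad \phi\dim(A) = \sup_{M \in \operatorname{mod} A} \phi(M).$$ Let $\mathbb{P}^{\ge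 1}$ be the (finite) set of paths of $Q$ of length at least one that are nonzero in $A$. Then $$\phi\Big(\bigoplus_{\rho \in \mathbb{P}^{\ge 1}} \rho A\Big) \;\le\; \phi\dim(A) \;\le\; \phi\Big(\bigoplus_{\rho \in \mathbb{P}^{\ge 1}} \rho A\Big) + 2 .$$ -/

import Mathlib

universe u v w

noncomputable section

/-! ### Path algebras, admissible ideals, monomial ideals -/

section PathAlgebra

/-- The paths of a quiver `V`, of any length `≥ 0` and with any endpoints. -/
abbrev QPath (V : Type v) [Quiver.{w} V] : Type (max v w) := Σ a b : V, Quiver.Path a b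

/-- The length of a path. -/
def QPath.length {V : Type v} [Quiver.{w} V] (p : QPath V) : ℕ := p.2.2.length

/-- The path algebra of `V` over `k`: the vector space with basis the paths of `V`.  The product of
two paths is their concatenation "first `p`, then `q`" when `p` ends where `q` starts, and zero
otherwise. -/
def PathAlgebra (k : Type u) (V : Type v) [Field k] [Quiver.{w} V] : Type (max u v w) :=
  QPath V →₀ k

namespace PathAlgebra

variable {k : Type u} {V : Type v} [Field k] [Quiver.{w} V]

instance : AddCommGroup (PathAlgebra k V) := inferInstanceAs (AddCommGroup (QPath V →₀ k))

instance : Module k (PathAlgebra k V) := inferInstanceAs (Module k (QPath V →₀ k))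

variable (k) in
/-- A path as a basis element of the path algebra. -/
def ofPath (p : QPath V) : PathAlgebra k V := Finsupp.single p (1 : k)

variable (k V) in
/-- The paths form a basis of the path algebra. -/
def basis : Module.Basis (QPath V) k (PathAlgebra k V) := Module.Basis.ofRepr (LinearEquiv.refl k _)

theorem basis_apply (p : QPath V) : basis k V p = ofPath k p := rfl

variable (k) in
open Classical in
/-- The product of two paths. -/
def pathMul (p q : QPath V) : PathAlgebra k V :=
  if h : p.2.1 = q.1 then ofPath k ⟨p.1, q.2.1, p.2.2.comp (q.2.2.cast h.symm rfl)⟩ else 0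

variable (k V) in
/-- The bilinear extension of the product of paths. -/
def mulHom : PathAlgebra k V →ₗ[k] PathAlgebra k V →ₗ[k] PathAlgebra k V :=
  (basis k V).constr k fun p => (basis k V).constr k fun q => pathMul k p q

instance : Mul (PathAlgebra k V) := ⟨fun x y => mulHom k V x y⟩

theorem mul_def (x y : PathAlgebra k V) : x * y = mulHom k V x y := rfl

theorem ofPath_mul_ofPath (p q : QPath V) : ofPath k p * ofPath k q = pathMul k p q := by
  rw [mul_def, ← basis_apply, ← basis_apply, mulHom, Module.Basis.constr_basis,
    Module.Basis.constr_basis]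

theorem ofPath_mul_of_eq {a b c : V} (p : Quiver.Path a b) (q : Quiver.Path b c) :
    ofPath k ⟨a, b, p⟩ * ofPath k ⟨b, c, q⟩ = ofPath k ⟨a, c, p.comp q⟩ := by
  rw [ofPath_mul_ofPath, pathMul, dif_pos rfl]
  rfl

theorem ofPath_mul_of_ne {p q : QPath V} (h : p.2.1 ≠ q.1) : ofPath k p * ofPath k q = 0 := by
  rw [ofPath_mul_ofPath, pathMul, dif_neg h]

/-- Linear maps which agree on paths are equal. -/
theorem hom_ext {M : Type*} [AddCommGroup M] [Module k M] {f g : PathAlgebra k V →ₗ[k] M}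
    (h : ∀ p, f (ofPath k p) = g (ofPath k p)) : f = g :=
  (basis k V).ext h

theorem ofPath_mul_assoc (p q r : QPath V) :
    ofPath k p * ofPath k q * ofPath k r = ofPath k p * (ofPath k q * ofPath k r) := by
  have z1 (x : PathAlgebra k V) : 0 * x = 0 := by rw [mul_def, map_zero, LinearMap.zero_apply]
  have z2 (x : PathAlgebra k V) : x * 0 = 0 := by rw [mul_def, map_zero]
  obtain ⟨a, b, p⟩ := p
  obtain ⟨b', c, q⟩ := q
  obtain ⟨c', d, r⟩ := r
  by_cases h1 : b = b'
  · subst h1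
    by_cases h2 : c = c'
    · subst h2
      simp only [ofPath_mul_of_eq, Quiver.Path.comp_assoc]
    · rw [ofPath_mul_of_eq, ofPath_mul_of_ne (by exact h2), ofPath_mul_of_ne (by exact h2), z2]
  · rw [ofPath_mul_of_ne (by exact h1), z1]
    by_cases h2 : c = c'
    · subst h2
      rw [ofPath_mul_of_eq, ofPath_mul_of_ne (by exact h1)]
    · rw [ofPath_mul_of_ne (by exact h2), z2]

theorem induction_path {motive : PathAlgebra k V → Prop} (x : PathAlgebra k V) (zero : motive 0)
    (add : ∀ x y, motive x → motive y → motive (x + y))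
    (smul : ∀ (c : k) (p : QPath V), motive (c • ofPath k p)) : motive x := by
  refine Finsupp.induction_linear x zero add fun p c => ?_
  have h : (Finsupp.single p c : QPath V →₀ k) = c • Finsupp.single p 1 := by
    rw [Finsupp.smul_single, smul_eq_mul, mul_one]
  rw [h]
  exact smul c p

variable [Fintype V]

/-- The unit is the sum of the trivial paths. -/
instance : One (PathAlgebra k V) := ⟨∑ a : V, ofPath k ⟨a, a, Quiver.Path.nil⟩⟩

theorem one_def : (1 : PathAlgebra k V) = ∑ a : V, ofPath k ⟨a, a, Quiver.Path.nil⟩ := rfl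

instance : Ring (PathAlgebra k V) where
  __ := (inferInstance : AddCommGroup (PathAlgebra k V))
  left_distrib x y z := by simp only [mul_def, map_add]
  right_distrib x y z := by simp only [mul_def, map_add, LinearMap.add_apply]
  zero_mul x := by rw [mul_def, map_zero, LinearMap.zero_apply]
  mul_zero x := by rw [mul_def, map_zero]
  mul_assoc x y z := by
    induction x using induction_path with
    | zero => simp only [mul_def, map_zero, LinearMap.zero_apply]
    | add x x' hx hx' =>
      simp only [mul_def, map_add, LinearMap.add_apply] at hx hx' ⊢
      rw [hx, hx']
    | smul c p =>
      induction y using induction_path with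
      | zero => simp only [mul_def, map_zero, LinearMap.zero_apply]
      | add y y' hy hy' =>
        simp only [mul_def, map_add, LinearMap.add_apply] at hy hy' ⊢
        rw [hy, hy']
      | smul d q =>
        induction z using induction_path with
        | zero => simp only [mul_def, map_zero]
        | add z z' hz hz' =>
          simp only [mul_def, map_add] at hz hz' ⊢
          rw [hz, hz']
        | smul e r =>
          have h := ofPath_mul_assoc (k := k) p q r
          simp only [mul_def] at h
          simp only [mul_def, map_smul, LinearMap.smul_apply, h]
  one_mul x := by
    induction x using induction_path with
    | zero => rw [mul_def, map_zero]
    | add x x' hx hx' =>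
      simp only [mul_def, map_add] at hx hx' ⊢
      rw [hx, hx']
    | smul c p =>
      obtain ⟨a, b, p⟩ := p
      rw [mul_def, map_smul, one_def, map_sum, LinearMap.sum_apply, Finset.sum_eq_single a]
      · rw [← mul_def, ofPath_mul_of_eq, Quiver.Path.nil_comp]
      · intro a' _ h
        rw [← mul_def, ofPath_mul_of_ne (by exact h)]
      · intro h
        exact absurd (Finset.mem_univ a) h
  mul_one x := by
    induction x using induction_path with
    | zero => rw [mul_def, map_zero, LinearMap.zero_apply]
    | add x x' hx hx' =>
      simp only [mul_def, map_add, LinearMap.add_apply] at hx hx' ⊢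
      rw [hx, hx']
    | smul c p =>
      obtain ⟨a, b, p⟩ := p
      rw [mul_def, map_smul, LinearMap.smul_apply, one_def, map_sum, Finset.sum_eq_single b]
      · rw [← mul_def, ofPath_mul_of_eq, Quiver.Path.comp_nil]
      · intro b' _ h
        rw [← mul_def, ofPath_mul_of_ne (by exact Ne.symm h)]
      · intro h
        exact absurd (Finset.mem_univ b) h

instance : Algebra k (PathAlgebra k V) :=
  Algebra.ofModule (fun c x y => by simp only [mul_def, map_smul, LinearMap.smul_apply])
    (fun c x y => by simp only [mul_def, map_smul])

variable (k V) in
/-- The two-sided ideal of the path algebra generated by the arrows. -/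
def arrowIdeal : TwoSidedIdeal (PathAlgebra k V) :=
  TwoSidedIdeal.span {x | ∃ p : QPath V, p.length = 1 ∧ x = ofPath k p}

/-- An admissible ideal: `J ^ m ⊆ I ⊆ J ^ 2` for some `m ≥ 2`, with `J` the arrow ideal. -/
class IsAdmissible (I : TwoSidedIdeal (PathAlgebra k V)) : Prop where
  exists_pow_le : ∃ m : ℕ, 2 ≤ m ∧ (arrowIdeal k V).asIdeal ^ m ≤ I.asIdeal
  le_sq : I.asIdeal ≤ (arrowIdeal k V).asIdeal ^ 2

/-- A monomial ideal: a two-sided ideal generated by a set of paths. -/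
def IsMonomial (I : TwoSidedIdeal (PathAlgebra k V)) : Prop :=
  ∃ S : Set (QPath V), I = TwoSidedIdeal.span (ofPath k '' S)

/-- The quotient algebra `kQ / I`. -/
abbrev QuotAlg (I : TwoSidedIdeal (PathAlgebra k V)) : Type (max u v w) :=
  PathAlgebra k V ⧸ I.asIdeal

/-- The residue class of a path in `kQ / I`. -/
def pathClass (I : TwoSidedIdeal (PathAlgebra k V)) (p : QPath V) : QuotAlg I :=
  Ideal.Quotient.mk I.asIdeal (ofPath k p)

theorem ofPath_mem_pow (n : ℕ) (p : QPath V) (hp : p.length = n) :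
    ofPath k p ∈ (arrowIdeal k V).asIdeal ^ n := by
  induction n generalizing p with
  | zero => rw [Submodule.pow_zero, Ideal.one_eq_top]; trivial
  | succ n ih =>
    obtain ⟨a, b, p⟩ := p
    cases p with
    | nil => exact absurd hp (Nat.succ_ne_zero n).symm
    | @cons c _ p e =>
      have h : ofPath k ⟨a, b, p.cons e⟩ = ofPath k ⟨a, c, p⟩ * ofPath k ⟨c, b, e.toPath⟩ := by
        rw [ofPath_mul_of_eq]; rfl
      rw [h, Submodule.pow_succ]
      exact Ideal.mul_mem_mul (ih ⟨a, c, p⟩ (Nat.succ.inj hp))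
        (TwoSidedIdeal.subset_span ⟨⟨c, b, e.toPath⟩, rfl, rfl⟩)

theorem finite_paths_length_eq [∀ a b : V, Finite (a ⟶ b)] (n : ℕ) :
    {p : QPath V | p.length = n}.Finite := by
  induction n with
  | zero =>
    refine (Set.finite_range fun a : V => (⟨a, a, Quiver.Path.nil⟩ : QPath V)).subset ?_
    rintro ⟨a, b, p⟩ hp
    cases p with
    | nil => exact ⟨a, rfl⟩
    | cons p e => exact absurd hp (Nat.succ_ne_zero _)
  | succ n ih =>
    have := ih.to_subtype
    refine (Set.finite_range fun x : (Σ p : {p : QPath V | p.length = n}, Σ b : V, p.1.2.1 ⟶ b) =>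
      (⟨x.1.1.1, x.2.1, x.1.1.2.2.cons x.2.2⟩ : QPath V)).subset ?_
    rintro ⟨a, b, p⟩ hp
    cases p with
    | nil => exact absurd hp (Nat.succ_ne_zero n).symm
    | @cons c _ p e => exact ⟨⟨⟨⟨a, c, p⟩, Nat.succ.inj hp⟩, b, e⟩, rfl⟩

/-- Only finitely many paths are nonzero modulo an admissible ideal. -/
theorem finite_pathClass_ne_zero [∀ a b : V, Finite (a ⟶ b)]
    (I : TwoSidedIdeal (PathAlgebra k V)) [IsAdmissible I] :
    {p : QPath V | pathClass I p ≠ 0}.Finite := by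
  obtain ⟨m, -, hm⟩ := IsAdmissible.exists_pow_le (I := I)
  refine ((Set.finite_lt_nat m).biUnion fun n _ => finite_paths_length_eq (V := V) n).subset ?_
  intro p hp
  refine Set.mem_biUnion (x := p.length) ?_ rfl
  refine (not_le (a := m) (b := p.length)).mp fun h => hp ?_
  exact Ideal.Quotient.eq_zero_iff_mem.mpr (hm (Ideal.pow_le_pow_right h (ofPath_mem_pow _ p rfl)))

/-- The quotient of the path algebra of a finite quiver by an admissible ideal is finite
dimensional. -/
instance [∀ a b : V, Finite (a ⟶ b)] (I : TwoSidedIdeal (PathAlgebra k V)) [IsAdmissible I] :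
    Module.Finite k (QuotAlg I) := by
  refine ⟨⟨((finite_pathClass_ne_zero I).image (pathClass I)).toFinset, ?_⟩⟩
  rw [Set.Finite.coe_toFinset, eq_top_iff]
  rintro x -
  obtain ⟨x, rfl⟩ := Ideal.Quotient.mkₐ_surjective k I.asIdeal x
  induction x using induction_path with
  | zero => rw [map_zero]; exact zero_mem _
  | add x y hx hy => rw [map_add]; exact add_mem hx hy
  | smul c p =>
    rw [map_smul]
    refine Submodule.smul_mem _ c ?_
    by_cases h : pathClass I p = 0
    · have h' : Ideal.Quotient.mkₐ k I.asIdeal (ofPath k p) = 0 := h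
      rw [h']
      exact zero_mem _
    · exact Submodule.subset_span ⟨p, h, rfl⟩

instance [∀ a b : V, Finite (a ⟶ b)] (I : TwoSidedIdeal (PathAlgebra k V)) [IsAdmissible I] :
    IsArtinianRing (QuotAlg I)ᵐᵒᵖ :=
  IsArtinianRing.of_finite k (QuotAlg I)ᵐᵒᵖ

/-- The paths of length at least one which are nonzero in `kQ / I`. -/
abbrev NonzeroPath (I : TwoSidedIdeal (PathAlgebra k V)) : Type (max v w) :=
  {p : QPath V // 1 ≤ p.length ∧ pathClass I p ≠ 0}

instance [∀ a b : V, Finite (a ⟶ b)] (I : TwoSidedIdeal (PathAlgebra k V)) [IsAdmissible I] :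
    Finite (NonzeroPath I) :=
  ((finite_pathClass_ne_zero I).subset fun _ h => h.2).to_subtype

/-- The right ideal `ρ A` of `A = kQ / I` generated by a path `ρ`, as a right `A`-module. -/
abbrev pathIdeal (I : TwoSidedIdeal (PathAlgebra k V)) (p : QPath V) :
    Submodule (QuotAlg I)ᵐᵒᵖ (QuotAlg I) :=
  Submodule.span (QuotAlg I)ᵐᵒᵖ {pathClass I p}

open scoped DirectSum in
/-- The right `A`-module `⨁ ρ A`, where `ρ` runs over the nonzero paths of length at least one. -/
def sumPathIdeals [∀ a b : V, Finite (a ⟶ b)] (I : TwoSidedIdeal (PathAlgebra k V))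
    [IsAdmissible I] : FGModuleCat.{max u v w} (QuotAlg I)ᵐᵒᵖ :=
  FGModuleCat.of (QuotAlg I)ᵐᵒᵖ (⨁ p : NonzeroPath I, pathIdeal I p.1)

end PathAlgebra

end PathAlgebra

/-! ### The Igusa-Todorov function -/

namespace IgusaTodorov

variable (R : Type u) [Ring R]

/-- The relations of `K₀`: `[M] - [M'] - [M'']` whenever `M ≅ M' ⊕ M''`, and `[P]` for `P`
projective. -/
def K0Rel : Set (FreeAbelianGroup (FGModuleCat.{u} R)) :=
  {x | ∃ M M' M'' : FGModuleCat.{u} R, Nonempty (M ≃ₗ[R] M' × M'') ∧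
    x = FreeAbelianGroup.of M - FreeAbelianGroup.of M' - FreeAbelianGroup.of M''} ∪
  {x | ∃ P : FGModuleCat.{u} R, Module.Projective R P ∧ x = FreeAbelianGroup.of P}

/-- The abelian group generated by the symbols `[M]`, for `M` a finitely generated module, modulo
the relations `[M] = [M'] + [M'']` if `M ≅ M' ⊕ M''`, and `[P] = 0` if `P` is projective. -/
abbrev K0 : Type (u + 1) :=
  FreeAbelianGroup (FGModuleCat.{u} R) ⧸ AddSubgroup.closure (K0Rel R)

variable {R}

/-- The class `[M]`. -/
def K0.cls (M : FGModuleCat.{u} R) : K0 R :=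
  QuotientAddGroup.mk' (AddSubgroup.closure (K0Rel R)) (FreeAbelianGroup.of M)

theorem K0.cls_prod {M M' M'' : FGModuleCat.{u} R} (e : M ≃ₗ[R] M' × M'') :
    K0.cls M = K0.cls M' + K0.cls M'' := by
  have h : QuotientAddGroup.mk' (AddSubgroup.closure (K0Rel R))
      (FreeAbelianGroup.of M - FreeAbelianGroup.of M' - FreeAbelianGroup.of M'') = 0 :=
    (QuotientAddGroup.eq_zero_iff _).mpr
      (AddSubgroup.subset_closure (Or.inl ⟨M, M', M'', ⟨e⟩, rfl⟩))
  rw [map_sub, map_sub, sub_sub, sub_eq_zero] at h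
  exact h

theorem K0.cls_projective (P : FGModuleCat.{u} R) (h : Module.Projective R P) :
    K0.cls P = 0 :=
  (QuotientAddGroup.eq_zero_iff _).mpr (AddSubgroup.subset_closure (Or.inr ⟨P, h, rfl⟩))

theorem K0.cls_congr {M N : FGModuleCat.{u} R} (e : M ≃ₗ[R] N) : K0.cls M = K0.cls N := by
  have h := K0.cls_prod (M := M) (M' := N) (M'' := FGModuleCat.of R PUnit.{u + 1})
    (e.trans (LinearEquiv.prodUnique (R := R) (M := N) (M₂ := PUnit.{u + 1})).symm)
  rw [h, K0.cls_projective (FGModuleCat.of R PUnit.{u + 1}) (inferInstanceAs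
    (Module.Projective R PUnit.{u + 1})), add_zero]

/-- A projective cover: a surjection from a projective module with superfluous kernel. -/
structure IsProjectiveCover {P M : Type*} [AddCommGroup P] [Module R P] [AddCommGroup M]
    [Module R M] (f : P →ₗ[R] M) : Prop where
  projective : Module.Projective R P
  surjective : Function.Surjective f
  superfluous : ∀ N : Submodule R P, N ⊔ LinearMap.ker f = ⊤ → N = ⊤

/-- Finitely generated modules over an artinian ring have projective covers. -/
theorem exists_isProjectiveCover [IsArtinianRing R] (M : FGModuleCat.{u} R) :
    ∃ (P : FGModuleCat.{u} R) (f : P →ₗ[R] M), IsProjectiveCover f := by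
  let T : Set ℕ∞ := {n | ∃ (P : FGModuleCat.{u} R) (f : P →ₗ[R] M), Module.Projective R P ∧
    Function.Surjective f ∧ Module.length R P = n}
  have hT : T.Nonempty := by
    obtain ⟨n, f, hf⟩ := Module.Finite.exists_fin' R M
    exact ⟨_, FGModuleCat.of R (Fin n → R), f, inferInstanceAs (Module.Projective R (Fin n → R)),
      hf, rfl⟩
  obtain ⟨n, ⟨P, f, hP, hf, hn⟩, hmin⟩ := wellFounded_lt.has_min T hT
  refine ⟨P, f, hP, hf, fun N hN => ?_⟩
  have hfN : Function.Surjective (f ∘ₗ N.subtype) := by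
    intro y
    obtain ⟨x, rfl⟩ := hf y
    have hx : x ∈ N ⊔ LinearMap.ker f := hN ▸ Submodule.mem_top
    obtain ⟨a, ha, b, hb, rfl⟩ := Submodule.mem_sup.mp hx
    refine ⟨⟨a, ha⟩, ?_⟩
    rw [map_add, LinearMap.mem_ker.mp hb, add_zero]
    rfl
  obtain ⟨h, hh⟩ := Module.projective_lifting_property (f ∘ₗ N.subtype) f hfN
  let g : Module.End R P := N.subtype ∘ₗ h
  have hg : ∀ (i : ℕ) (x : P), f ((g ^ i) x) = f x := by
    intro i x
    induction i with
    | zero => rfl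
    | succ i ih =>
      rw [pow_succ', Module.End.mul_apply, ← ih]
      exact LinearMap.congr_fun hh ((g ^ i) x)
  obtain ⟨i, hi⟩ := Filter.eventually_atTop.mp (LinearMap.eventually_isCompl_ker_pow_range_pow g)
  have hc := hi (i + 1) (Nat.le_succ i)
  set L := LinearMap.range (g ^ (i + 1)) with hL
  have hLN : L ≤ N := by
    rintro _ ⟨x, rfl⟩
    rw [pow_succ', Module.End.mul_apply]
    exact (h ((g ^ i) x)).2
  have hLP : Module.Projective R L :=
    Module.Projective.of_split L.subtype (L.projectionOnto _ hc.symm)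
      (LinearMap.ext fun x => Submodule.projectionOnto_apply_left hc.symm x)
  by_contra hne
  have hlt : L < ⊤ := lt_of_le_of_lt hLN (lt_top_iff_ne_top.mpr hne)
  refine hmin (Module.length R L) ⟨FGModuleCat.of R L, f ∘ₗ L.subtype, hLP, ?_, rfl⟩ ?_
  · intro y
    obtain ⟨x, rfl⟩ := hf y
    exact ⟨⟨(g ^ (i + 1)) x, x, rfl⟩, hg (i + 1) x⟩
  · rw [← hn]
    exact Submodule.length_lt hlt.ne

section Syzygy

variable [IsArtinianRing R]

/-- The projective cover `P(M)` of a finitely generated module `M`. -/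
def projCover (M : FGModuleCat.{u} R) : FGModuleCat.{u} R := (exists_isProjectiveCover M).choose

/-- The surjection `P(M) → M`. -/
def projCoverMap (M : FGModuleCat.{u} R) : projCover M →ₗ[R] M :=
  (exists_isProjectiveCover M).choose_spec.choose

theorem isProjectiveCover_projCoverMap (M : FGModuleCat.{u} R) :
    IsProjectiveCover (projCoverMap M) :=
  (exists_isProjectiveCover M).choose_spec.choose_spec

/-- The syzygy `Ω(M)`: the kernel of the projective cover of `M`. -/
def syzygy (M : FGModuleCat.{u} R) : FGModuleCat.{u} R :=
  FGModuleCat.of R (LinearMap.ker (projCoverMap M))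

/-- The kernels of two surjections from projective modules onto the same module have the same
class. -/
theorem cls_ker_eq {M P Q : FGModuleCat.{u} R} (f : P →ₗ[R] M) (g : Q →ₗ[R] M)
    (hP : Module.Projective R P) (hQ : Module.Projective R Q)
    (hf : Function.Surjective f) (hg : Function.Surjective g) :
    K0.cls (FGModuleCat.of R (LinearMap.ker f)) = K0.cls (FGModuleCat.of R (LinearMap.ker g)) := by
  have key : ∀ {P Q : FGModuleCat.{u} R} (f : P →ₗ[R] M) (g : Q →ₗ[R] M)
      (_ : Module.Projective R Q) (_ : Function.Surjective f),
      K0.cls (FGModuleCat.of R (LinearMap.ker (f.coprod (-g)))) =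
        K0.cls (FGModuleCat.of R (LinearMap.ker f)) := by
    intro P Q f g hQ hf
    obtain ⟨s, hs⟩ := Module.projective_lifting_property f g hf
    have hs' : ∀ x, f (s x) = g x := fun x => LinearMap.congr_fun hs x
    let j : LinearMap.ker f →ₗ[R] LinearMap.ker (f.coprod (-g)) :=
      (LinearMap.inl R P Q ∘ₗ (LinearMap.ker f).subtype).codRestrict _ fun x => by
        simp
    let t : Q →ₗ[R] LinearMap.ker (f.coprod (-g)) :=
      (s.prod LinearMap.id).codRestrict _ fun x => by simp [hs']
    let pr : LinearMap.ker (f.coprod (-g)) →ₗ[R] Q :=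
      LinearMap.snd R P Q ∘ₗ (LinearMap.ker (f.coprod (-g))).subtype
    have hj : Function.Injective j := by
      intro x y hxy
      have := congrArg (fun z : LinearMap.ker (f.coprod (-g)) => z.1.1) hxy
      exact Subtype.ext this
    have hex : LinearMap.range j = LinearMap.ker pr := by
      ext ⟨⟨x, y⟩, hxy⟩
      constructor
      · rintro ⟨z, hz⟩
        exact (congrArg (fun z : LinearMap.ker (f.coprod (-g)) => z.1.2) hz).symm
      · intro hy
        have hy' : y = 0 := hy
        subst hy'
        have hx : f x = 0 := by simpa using hxy
        exact ⟨⟨x, hx⟩, rfl⟩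
    let e := lequivProdOfRightSplitExact (f := t) (g := pr) hj hex (LinearMap.ext fun _ => rfl)
    rw [K0.cls_prod (M := FGModuleCat.of R (LinearMap.ker (f.coprod (-g))))
      (M' := FGModuleCat.of R (LinearMap.ker f)) (M'' := Q) e.symm, K0.cls_projective Q hQ,
      add_zero]
  rw [← key f g hQ hf, ← key g f hP hg]
  have hmem : ∀ x : P × Q, x ∈ LinearMap.ker (f.coprod (-g)) ↔
      x.swap ∈ LinearMap.ker (g.coprod (-f)) := by
    intro x
    simp only [LinearMap.mem_ker, LinearMap.coprod_apply, LinearMap.neg_apply, Prod.fst_swap,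
      Prod.snd_swap, ← sub_eq_add_neg, sub_eq_zero]
    exact eq_comm
  refine K0.cls_congr (M := FGModuleCat.of R (LinearMap.ker (f.coprod (-g))))
    (N := FGModuleCat.of R (LinearMap.ker (g.coprod (-f))))
    ((LinearEquiv.prodComm R P Q).ofSubmodules _ _ ?_)
  ext x
  rw [Submodule.mem_map_equiv, hmem]
  rfl

/-- The syzygies may be computed, in `K₀`, from any surjection from a projective module. -/
theorem cls_syzygy_eq {M P : FGModuleCat.{u} R} (f : P →ₗ[R] M) (hP : Module.Projective R P)
    (hf : Function.Surjective f) :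
    K0.cls (syzygy M) = K0.cls (FGModuleCat.of R (LinearMap.ker f)) :=
  cls_ker_eq (projCoverMap M) f (isProjectiveCover_projCoverMap M).projective hP
    (isProjectiveCover_projCoverMap M).surjective hf

theorem cls_syzygy_projective (P : FGModuleCat.{u} R) (hP : Module.Projective R P) :
    K0.cls (syzygy P) = 0 := by
  rw [cls_syzygy_eq (LinearMap.id : P →ₗ[R] P) hP Function.surjective_id]
  refine K0.cls_projective _ ?_
  have : Subsingleton (LinearMap.ker (LinearMap.id : P →ₗ[R] P)) := by
    rw [LinearMap.ker_id]; infer_instance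
  exact inferInstanceAs (Module.Projective R (LinearMap.ker (LinearMap.id : P →ₗ[R] P)))

theorem cls_syzygy_prod {M M' M'' : FGModuleCat.{u} R} (e : M ≃ₗ[R] M' × M'') :
    K0.cls (syzygy M) = K0.cls (syzygy M') + K0.cls (syzygy M'') := by
  have h' := isProjectiveCover_projCoverMap M'
  have h'' := isProjectiveCover_projCoverMap M''
  have := h'.projective
  have := h''.projective
  let F : (projCover M' × projCover M'') →ₗ[R] M :=
    e.symm.toLinearMap ∘ₗ (projCoverMap M').prodMap (projCoverMap M'')
  rw [cls_syzygy_eq (P := FGModuleCat.of R (projCover M' × projCover M'')) F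
    (inferInstanceAs (Module.Projective R (projCover M' × projCover M'')))
    (e.symm.surjective.comp (h'.surjective.prodMap h''.surjective))]
  refine K0.cls_prod (M := FGModuleCat.of R (LinearMap.ker F)) ?_
  have hF : LinearMap.ker F =
      (LinearMap.ker (projCoverMap M')).prod (LinearMap.ker (projCoverMap M'')) := by
    rw [← LinearMap.ker_prodMap]
    exact LinearEquiv.ker_comp _ _
  exact (LinearEquiv.ofEq _ _ hF).trans
    { toFun := fun x => (⟨x.1.1, x.2.1⟩, ⟨x.1.2, x.2.2⟩)
      invFun := fun y => ⟨(y.1.1, y.2.1), y.1.2, y.2.2⟩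
      map_add' := fun _ _ => rfl
      map_smul' := fun _ _ => rfl
      left_inv := fun _ => rfl
      right_inv := fun _ => rfl }

variable (R) in
/-- The endomorphism of `K₀` induced by `Ω`. -/
def omegaBar : K0 R →+ K0 R :=
  QuotientAddGroup.lift (AddSubgroup.closure (K0Rel R))
    (FreeAbelianGroup.lift fun M => K0.cls (syzygy M)) (by
      rw [AddSubgroup.closure_le]
      rintro x (⟨M, M', M'', ⟨e⟩, rfl⟩ | ⟨P, hP, rfl⟩)
      · simp only [SetLike.mem_coe, AddMonoidHom.mem_ker, map_sub, FreeAbelianGroup.lift_apply_of,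
          cls_syzygy_prod e]
        abel
      · simp only [SetLike.mem_coe, AddMonoidHom.mem_ker, FreeAbelianGroup.lift_apply_of,
          cls_syzygy_projective P hP])

theorem omegaBar_cls (M : FGModuleCat.{u} R) : omegaBar R (K0.cls M) = K0.cls (syzygy M) := by
  rw [omegaBar, K0.cls, QuotientAddGroup.mk'_apply, QuotientAddGroup.lift_mk,
    FreeAbelianGroup.lift_apply_of]

end Syzygy

/-- Indecomposable modules. -/
def IsIndecomposable (M : FGModuleCat.{u} R) : Prop :=
  Nontrivial M ∧ ∀ X Y : Submodule R M, IsCompl X Y → X = ⊥ ∨ Y = ⊥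

/-- `N` is (isomorphic to) a direct summand of `M`. -/
def IsSummand (N M : FGModuleCat.{u} R) : Prop :=
  ∃ N' : FGModuleCat.{u} R, Nonempty (M ≃ₗ[R] N × N')

/-- The subgroup `⟨add M⟩` of `K₀` generated by the classes of the indecomposable direct summands
of `M`. -/
def addSpan (M : FGModuleCat.{u} R) : AddSubgroup (K0 R) :=
  AddSubgroup.closure {x | ∃ N : FGModuleCat.{u} R, IsIndecomposable N ∧ IsSummand N M ∧
    x = K0.cls N}

variable [IsArtinianRing R]

/-- The Igusa-Todorov function: `φ(M)` is the least `l` such that, for all `s ≥ 0`, the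
endomorphism `Ω̄` is injective on `Ω̄ ^ (l + s) ⟨add M⟩`. -/
def phi (M : FGModuleCat.{u} R) : ℕ :=
  sInf {l : ℕ | ∀ s : ℕ, Set.InjOn (omegaBar R) ((omegaBar R)^[l + s] '' (addSpan M : Set (K0 R)))}

variable (R) in
/-- The `φ`-dimension: the supremum of `φ(M)` over all finitely generated modules `M`. -/
def phiDim : ℕ∞ := ⨆ M : FGModuleCat.{u} R, (phi M : ℕ∞)

end IgusaTodorov

end

/-! Write `A = kQ / I` and `S = ⨁ ρ A`, the sum over the nonzero paths `ρ` of length at least one.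
The lower bound holds because `S` is one of the modules in the supremum. For the upper bound it
suffices that `Ω̄ ^ 2` maps `K₀` into `⟨add S⟩` and that this subgroup is finitely generated: then
the kernels of the powers of `Ω̄` on `⟨add S⟩` stabilise, so that `Ω̄` is injective on
`Ω̄ ^ (φ(S) + s) ⟨add S⟩` for every `s`, and this set contains `Ω̄ ^ (φ(S) + 2 + s) ⟨add M⟩` for
every module `M` (`IgusaTodorov.injOn_phi`, `IgusaTodorov.phiDim_le_phi_add`).

Up to projective summands, a second syzygy is the kernel `L` of a map `A ^ m → A ^ n`, and such a
kernel is a direct sum of right ideals `σ A` with `σ` a path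
(`PathAlgebra.exists_ker_equiv_pi_pathIdeal`). Indeed, since `I` is monomial, the nonzero paths form
a basis of `A`. The map is left multiplication by a matrix, and left multiplication does not change
the terminal segment of length `|σ|` of a path which is at least as long as `σ`. So if all terms of
`y ∈ L` are at least as long as `σ`, the part of `y` made of the paths ending in `σ` lies in `L`
again; this property of `L` is called `PathAlgebra.SuffixClosed`. Order the terms "path `p` in
coordinate `j`" with the short paths first. By suffix-closedness, an element of `L` with first term
`(j, σ)` can be replaced by one of the form `z * σ`, and left multiplication by `z` embeds `σ A`
into `L`, taking `σ t` to an element with first term `(j, σ t)`. Choosing one such element for each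
minimal first term, minimal for the relation of being an initial segment, every first term of `L`
is obtained exactly once, so these copies of `σ A` add up to `L` and their sum is direct
(`PathAlgebra.SuffixClosed.exists_equiv`).

The ideal `σ A` is projective if `σ` is trivial, and otherwise an indecomposable summand of `S`,
being local (`PathAlgebra.isIndecomposable_pathIdeal`). Finally, by Fitting's lemma every indecomposable
summand of `S` is isomorphic to some `ρ A`, so `⟨add S⟩` is generated by finitely many classes. -/

noncomputable section

/-! ### Concatenation of paths -/

namespace QPath

variable {V : Type v} [Quiver.{w} V]

/-- `IsComp p q r` says that `q` starts where `p` ends and that `r` is the path "first `p`, then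
`q`".  A relation is used because concatenation of paths with unspecified endpoints is partial. -/
inductive IsComp : QPath V → QPath V → QPath V → Prop
  | mk {a b c : V} (p : Quiver.Path a b) (q : Quiver.Path b c) :
    IsComp ⟨a, b, p⟩ ⟨b, c, q⟩ ⟨a, c, p.comp q⟩

/-- The trivial path at a vertex. -/
def trivial (a : V) : QPath V := ⟨a, a, Quiver.Path.nil⟩

namespace IsComp

variable {p p' q q' r r' s t : QPath V}

theorem unique (h : IsComp p q r) (h' : IsComp p q r') : r = r' := by
  cases h; cases h'; rfl

theorem length_eq (h : IsComp p q r) : r.length = p.length + q.length := by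
  cases h; exact Quiver.Path.length_comp _ _

theorem start_eq (h : IsComp p q r) : p.1 = r.1 := by
  cases h; rfl

theorem trivial_left (p : QPath V) : IsComp (trivial p.1) p p := by
  obtain ⟨a, b, p⟩ := p
  have h := IsComp.mk (Quiver.Path.nil : Quiver.Path a a) p
  rwa [Quiver.Path.nil_comp] at h

theorem trivial_right (p : QPath V) : IsComp p (trivial p.2.1) p := by
  obtain ⟨a, b, p⟩ := p
  exact IsComp.mk p (Quiver.Path.nil : Quiver.Path b b)

theorem assoc_left (h : IsComp p q r) (h' : IsComp r s t) : ∃ v, IsComp q s v ∧ IsComp p v t := by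
  cases h with
  | mk p q =>
    cases h' with
    | mk _ s =>
      refine ⟨_, .mk q s, ?_⟩
      rw [Quiver.Path.comp_assoc]
      exact .mk _ _

theorem assoc_right (h : IsComp q s r) (h' : IsComp p r t) :
    ∃ v, IsComp p q v ∧ IsComp v s t := by
  cases h with
  | mk q s =>
    cases h' with
    | mk p _ =>
      refine ⟨_, .mk p q, ?_⟩
      rw [← Quiver.Path.comp_assoc]
      exact .mk _ _

theorem exists_of_end_eq (h : p.2.1 = q.1) : ∃ r, IsComp p q r := by
  obtain ⟨a, b, p⟩ := p
  obtain ⟨b', c, q⟩ := q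
  obtain rfl : b = b' := h
  exact ⟨_, .mk p q⟩

theorem end_eq (h : IsComp p q r) : p.2.1 = q.1 := by
  cases h; rfl

theorem eq_trivial_of_length_eq_zero (h : p.length = 0) : p = trivial p.1 := by
  obtain ⟨a, b, p⟩ := p
  cases p with
  | nil => rfl
  | cons p e => exact absurd h (Nat.succ_ne_zero _)

theorem eq_of_trivial_left (h : IsComp p q r) (hp : p.length = 0) : q = r := by
  rw [eq_trivial_of_length_eq_zero hp] at h
  have h' := trivial_left q
  rw [show q.1 = p.1 from h.end_eq.symm] at h'
  exact h'.unique h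

/-- Of two ways to cut a path into two pieces, one refines the other. -/
theorem exists_between (h : IsComp p q r) (h' : IsComp p' q' r) (hl : p.length ≤ p'.length) :
    ∃ s, IsComp p s p' ∧ IsComp s q' q := by
  have key : ∀ {c d : V} (q' : Quiver.Path c d) (a b : V) (p : Quiver.Path a b)
      (q : Quiver.Path b d) (p' : Quiver.Path a c), p.comp q = p'.comp q' →
      p.length ≤ p'.length → ∃ s : Quiver.Path b c, p.comp s = p' ∧ s.comp q' = q := by
    intro c d q'
    induction q' with
    | nil => intro a b p q p' h _; exact ⟨q, h, rfl⟩
    | cons q' e ih =>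
      intro a b p q p' h hl
      cases q with
      | nil =>
        have := congrArg Quiver.Path.length h
        simp only [Quiver.Path.comp_nil, Quiver.Path.length_comp, Quiver.Path.length_cons] at this
        omega
      | cons q e₁ =>
        rw [Quiver.Path.comp_cons, Quiver.Path.comp_cons] at h
        obtain rfl := Quiver.Path.obj_eq_of_cons_eq_cons h
        obtain ⟨s, hs, hs'⟩ := ih _ _ p q p' (eq_of_heq (Quiver.Path.heq_of_cons_eq_cons h)) hl
        have he := eq_of_heq (Quiver.Path.hom_heq_of_cons_eq_cons h)
        subst he
        exact ⟨s, hs, by rw [Quiver.Path.comp_cons, hs']⟩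
  obtain ⟨a, b, p⟩ := p
  obtain ⟨a', c, p'⟩ := p'
  obtain ⟨b', d, q⟩ := q
  obtain ⟨c', d', q'⟩ := q'
  obtain ⟨x, y, r⟩ := r
  obtain rfl : b = b' := h.end_eq
  obtain rfl : c = c' := h'.end_eq
  obtain rfl : a = x := h.start_eq
  obtain rfl : a' = a := h'.start_eq
  obtain rfl : d = y := by cases h; rfl
  obtain rfl : d' = d := by cases h'; rfl
  have e := h.unique (.mk p q)
  have e' := h'.unique (.mk p' q')
  rw [e] at e'
  simp only [Sigma.mk.injEq, heq_eq_eq, true_and] at e'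
  obtain ⟨s, rfl, rfl⟩ := key q' a' b p q p' e' hl
  exact ⟨_, .mk p s, .mk s q'⟩

theorem eq_of_length_eq (h : IsComp p q r) (h' : IsComp p' q' r) (hl : p.length = p'.length) :
    p = p' ∧ q = q' := by
  obtain ⟨s, hs, hs'⟩ := h.exists_between h' hl.le
  have h0 : s.length = 0 := by have := hs.length_eq; omega
  refine ⟨?_, (eq_of_trivial_left hs' h0).symm⟩
  have he : p.2.1 = s.1 := hs.end_eq
  rw [eq_trivial_of_length_eq_zero h0, ← he] at hs
  exact (trivial_right p).unique hs

end IsComp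

/-- `σ` is a terminal segment of `w`. -/
def IsSuffix (σ w : QPath V) : Prop := ∃ u, IsComp u σ w

/-- `σ` is an initial segment of `w`. -/
def IsPrefix (σ w : QPath V) : Prop := ∃ u, IsComp σ u w

theorem isPrefix_refl (p : QPath V) : IsPrefix p p := ⟨_, IsComp.trivial_right p⟩

theorem IsPrefix.trans {p q r : QPath V} (h : IsPrefix p q) (h' : IsPrefix q r) :
    IsPrefix p r := by
  obtain ⟨u, hu⟩ := h
  obtain ⟨u', hu'⟩ := h'
  obtain ⟨v, -, hv⟩ := hu.assoc_left hu'
  exact ⟨v, hv⟩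

theorem IsPrefix.length_le {p q : QPath V} (h : IsPrefix p q) : p.length ≤ q.length := by
  obtain ⟨u, hu⟩ := h
  have := hu.length_eq
  omega

theorem IsPrefix.start_eq {p q : QPath V} (h : IsPrefix p q) : p.1 = q.1 := by
  obtain ⟨u, hu⟩ := h
  exact hu.start_eq

theorem IsPrefix.of_length_le {p q r : QPath V} (h : IsPrefix p r) (h' : IsPrefix q r)
    (hl : p.length ≤ q.length) : IsPrefix p q := by
  obtain ⟨u, hu⟩ := h
  obtain ⟨u', hu'⟩ := h'
  obtain ⟨s, hs, -⟩ := hu.exists_between hu' hl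
  exact ⟨s, hs⟩

theorem IsPrefix.eq_of_length_eq {p q r : QPath V} (h : IsPrefix p r) (h' : IsPrefix q r)
    (hl : p.length = q.length) : p = q := by
  obtain ⟨u, hu⟩ := h
  obtain ⟨u', hu'⟩ := h'
  exact (hu.eq_of_length_eq hu' hl).1

theorem IsComp.isSuffix_iff {σ p w r : QPath V} (h : IsComp p w r) (hl : σ.length ≤ w.length) :
    IsSuffix σ r ↔ IsSuffix σ w := by
  constructor
  · rintro ⟨u, hu⟩
    have h1 := h.length_eq
    have h2 := hu.length_eq
    obtain ⟨s, -, hs⟩ := h.exists_between hu (by omega)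
    exact ⟨s, hs⟩
  · rintro ⟨u, hu⟩
    obtain ⟨v, -, hv⟩ := hu.assoc_right h
    exact ⟨v, hv⟩

end QPath

namespace PathAlgebra

open QPath

variable {k : Type u} {V : Type v} [Field k] [Quiver.{w} V]

/-! ### Monomial ideals and coefficients in the quotient algebra -/

theorem ofPath_mul_of_isComp {p q r : QPath V} (h : IsComp p q r) :
    ofPath k p * ofPath k q = ofPath k r := by
  cases h; exact ofPath_mul_of_eq _ _

theorem exists_isComp_of_repr_mul_ne_zero {x y : PathAlgebra k V} {r : QPath V}
    (h : (basis k V).repr (x * y) r ≠ 0) :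
    ∃ p q, IsComp p q r ∧ (basis k V).repr x p ≠ 0 ∧ (basis k V).repr y q ≠ 0 := by
  by_contra! hc
  apply h
  rw [mul_def, mulHom, Module.Basis.constr_apply, Finsupp.sum, LinearMap.sum_apply, map_sum,
    Finsupp.finsetSum_apply]
  refine Finset.sum_eq_zero fun p hp => ?_
  rw [LinearMap.smul_apply, map_smul, Finsupp.smul_apply, Module.Basis.constr_apply, Finsupp.sum,
    map_sum, Finsupp.finsetSum_apply]
  refine smul_eq_zero_of_right _ (Finset.sum_eq_zero fun q hq => ?_)
  rw [map_smul, Finsupp.smul_apply, ← ofPath_mul_ofPath]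
  by_cases hpq : p.2.1 = q.1
  · obtain ⟨r', hr'⟩ := IsComp.exists_of_end_eq hpq
    rw [ofPath_mul_of_isComp hr', ← basis_apply, Module.Basis.repr_self]
    by_cases hr : r' = r
    · subst hr
      exact absurd (hc p q hr' (Finsupp.mem_support_iff.mp hp)) (Finsupp.mem_support_iff.mp hq)
    · rw [Finsupp.single_eq_of_ne (Ne.symm hr), smul_zero]
  · rw [ofPath_mul_of_ne hpq, map_zero, Finsupp.zero_apply, smul_zero]

variable [Fintype V] {I : TwoSidedIdeal (PathAlgebra k V)}

/-- Every path occurring in an element of a monomial ideal lies in the ideal. -/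
theorem IsMonomial.pathClass_eq_zero (hI : IsMonomial I) {x : PathAlgebra k V} (hx : x ∈ I)
    {p : QPath V} (hp : (basis k V).repr x p ≠ 0) : pathClass I p = 0 := by
  have mem_iff (q : QPath V) : pathClass I q = 0 ↔ ofPath k q ∈ I := Ideal.Quotient.eq_zero_iff_mem
  rw [mem_iff]
  let T : Set (PathAlgebra k V) := {x | ∀ p, (basis k V).repr x p ≠ 0 → ofPath k p ∈ I}
  have hadd {x y : PathAlgebra k V} (hx : x ∈ T) (hy : y ∈ T) : x + y ∈ T := by
    intro p hp
    rw [map_add, Finsupp.add_apply] at hp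
    by_cases h : (basis k V).repr x p = 0
    · exact hy p fun h' => hp (by rw [h, h', add_zero])
    · exact hx p h
  have hneg {x : PathAlgebra k V} (hx : x ∈ T) : -x ∈ T := by
    intro p hp
    rw [map_neg, Finsupp.neg_apply, neg_ne_zero] at hp
    exact hx p hp
  have hzero : (0 : PathAlgebra k V) ∈ T := by
    intro p hp
    rw [map_zero] at hp
    exact absurd rfl hp
  have hleft {x y : PathAlgebra k V} (hy : y ∈ T) : x * y ∈ T := by
    intro r hr
    obtain ⟨p, q, h, -, hq⟩ := exists_isComp_of_repr_mul_ne_zero hr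
    rw [← ofPath_mul_of_isComp h]
    exact I.mul_mem_left _ _ (hy q hq)
  have hright {x y : PathAlgebra k V} (hx : x ∈ T) : x * y ∈ T := by
    intro r hr
    obtain ⟨p, q, h, hp, -⟩ := exists_isComp_of_repr_mul_ne_zero hr
    rw [← ofPath_mul_of_isComp h]
    exact I.mul_mem_right _ _ (hx p hp)
  have hle : I ≤ TwoSidedIdeal.mk' T hzero hadd hneg hleft hright := by
    obtain ⟨S, hS⟩ := hI
    rw [hS, TwoSidedIdeal.span_le]
    rintro _ ⟨q, hq, rfl⟩
    simp only [SetLike.mem_coe, TwoSidedIdeal.mem_mk']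
    intro p hp
    rw [← basis_apply, Module.Basis.repr_self] at hp
    by_cases hpq : q = p
    · subst hpq
      rw [hS]
      exact TwoSidedIdeal.subset_span ⟨q, hq, rfl⟩
    · exact absurd (Finsupp.single_eq_of_ne (Ne.symm hpq)) hp
  have := hle hx
  rw [TwoSidedIdeal.mem_mk'] at this
  exact this p hp

theorem pathClass_mul_of_isComp {p q r : QPath V} (h : IsComp p q r) :
    pathClass I p * pathClass I q = pathClass I r := by
  rw [pathClass, pathClass, ← map_mul, ofPath_mul_of_isComp h, pathClass]

theorem pathClass_mul_of_ne {p q : QPath V} (h : p.2.1 ≠ q.1) :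
    pathClass I p * pathClass I q = 0 := by
  rw [pathClass, pathClass, ← map_mul, ofPath_mul_of_ne h, map_zero]

theorem pathClass_ne_zero_left {p q r : QPath V} (h : IsComp p q r) (hr : pathClass I r ≠ 0) :
    pathClass I p ≠ 0 := by
  intro hp
  rw [← pathClass_mul_of_isComp h, hp, zero_mul] at hr
  exact hr rfl

open Classical in
variable (I) in
/-- The linear endomorphism of the space of formal combinations of paths which deletes the paths
that vanish in `kQ / I`. -/
def deleteZeroPaths : PathAlgebra k V →ₗ[k] (QPath V →₀ k) where
  toFun x := ((basis k V).repr x).filter fun p => pathClass I p ≠ 0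
  map_add' x y := by rw [map_add, Finsupp.filter_add]
  map_smul' c x := by rw [map_smul, Finsupp.filter_smul, RingHom.id_apply]

theorem deleteZeroPaths_apply {x : PathAlgebra k V} {p : QPath V} (hp : pathClass I p ≠ 0) :
    deleteZeroPaths I x p = (basis k V).repr x p := by
  classical
  exact Finsupp.filter_apply_pos _ _ hp

theorem deleteZeroPaths_apply_of_eq_zero {x : PathAlgebra k V} {p : QPath V}
    (hp : pathClass I p = 0) : deleteZeroPaths I x p = 0 := by
  classical
  exact Finsupp.filter_apply_neg _ _ (not_not.mpr hp)

/-- The coefficients of an element of `kQ / I` in the basis of nonzero paths, for `I` a monomial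
ideal. -/
def coeffs (hI : IsMonomial I) : QuotAlg I →ₗ[k] (QPath V →₀ k) :=
  (LinearMap.ker (Ideal.Quotient.mkₐ k I.asIdeal).toLinearMap).liftQ (deleteZeroPaths I) (by
    intro x hx
    have hx' : x ∈ I := Ideal.Quotient.eq_zero_iff_mem.mp hx
    ext p
    by_cases h : pathClass I p = 0
    · exact deleteZeroPaths_apply_of_eq_zero h
    · rw [deleteZeroPaths_apply h, Finsupp.zero_apply]
      by_contra h'
      exact h (hI.pathClass_eq_zero hx' h')) ∘ₗ
  ((Ideal.Quotient.mkₐ k I.asIdeal).toLinearMap.quotKerEquivOfSurjective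
    (Ideal.Quotient.mkₐ_surjective k I.asIdeal)).symm.toLinearMap

theorem coeffs_mk (hI : IsMonomial I) (x : PathAlgebra k V) :
    coeffs hI (Ideal.Quotient.mkₐ k I.asIdeal x) = deleteZeroPaths I x := by
  have h : ((Ideal.Quotient.mkₐ k I.asIdeal).toLinearMap.quotKerEquivOfSurjective
      (Ideal.Quotient.mkₐ_surjective k I.asIdeal)).symm (Ideal.Quotient.mkₐ k I.asIdeal x) =
      Submodule.Quotient.mk x := by
    rw [LinearEquiv.symm_apply_eq]
    rfl
  rw [coeffs, LinearMap.comp_apply, LinearEquiv.coe_coe, h]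
  exact Submodule.liftQ_apply _ _ _

theorem coeffs_pathClass (hI : IsMonomial I) {p : QPath V} (hp : pathClass I p ≠ 0) :
    coeffs hI (pathClass I p) = Finsupp.single p 1 := by
  have h := coeffs_mk hI (ofPath k p)
  refine h.trans ?_
  ext q
  by_cases hq : pathClass I q = 0
  · rw [deleteZeroPaths_apply_of_eq_zero hq, Finsupp.single_eq_of_ne]
    rintro rfl
    exact hp hq
  · rw [deleteZeroPaths_apply hq, ← basis_apply, Module.Basis.repr_self]

theorem pathClass_ne_zero_of_coeffs_ne_zero (hI : IsMonomial I) {a : QuotAlg I} {p : QPath V}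
    (h : coeffs hI a p ≠ 0) : pathClass I p ≠ 0 := by
  intro hp
  obtain ⟨x, rfl⟩ := Ideal.Quotient.mkₐ_surjective k I.asIdeal a
  rw [coeffs_mk, deleteZeroPaths_apply_of_eq_zero hp] at h
  exact h rfl

theorem linearCombination_coeffs (hI : IsMonomial I) (a : QuotAlg I) :
    Finsupp.linearCombination k (pathClass I) (coeffs hI a) = a := by
  obtain ⟨x, rfl⟩ := Ideal.Quotient.mkₐ_surjective k I.asIdeal a
  induction x using induction_path with
  | zero => simp only [map_zero]
  | add x y hx hy => rw [map_add, map_add, map_add, hx, hy]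
  | smul c p =>
    simp only [map_smul]
    congr 1
    change Finsupp.linearCombination k (pathClass I) (coeffs hI (pathClass I p)) = pathClass I p
    by_cases hp : pathClass I p = 0
    · rw [hp, map_zero, map_zero]
    · rw [coeffs_pathClass hI hp, Finsupp.linearCombination_single, one_smul]

theorem coeffs_injective (hI : IsMonomial I) : Function.Injective (coeffs hI) :=
  Function.LeftInverse.injective (linearCombination_coeffs hI)

/-- Linear maps which agree on the paths occurring in `a` agree on `a`. -/
theorem map_eq_map_of_coeffs (hI : IsMonomial I) {M : Type*} [AddCommGroup M] [Module k M]
    {f g : QuotAlg I →ₗ[k] M} {a : QuotAlg I}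
    (h : ∀ p, coeffs hI a p ≠ 0 → f (pathClass I p) = g (pathClass I p)) : f a = g a := by
  rw [← linearCombination_coeffs hI a, Finsupp.linearCombination_apply, Finsupp.sum, map_sum,
    map_sum]
  refine Finset.sum_congr rfl fun p hp => ?_
  rw [map_smul, map_smul, h p (Finsupp.mem_support_iff.mp hp)]

/-- If all paths in `b` are at least as long as `p`, only the trivial paths in `a` contribute to
the coefficient of `p` in `a * b`. -/
theorem coeffs_mul_apply (hI : IsMonomial I) (a b : QuotAlg I) (p : QPath V)
    (hb : ∀ q, coeffs hI b q ≠ 0 → p.length ≤ q.length) :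
    coeffs hI (a * b) p = coeffs hI a (QPath.trivial p.1) * coeffs hI b p := by
  by_cases hp : pathClass I p = 0
  · have h0 (c : QuotAlg I) : coeffs hI c p = 0 := by
      by_contra h
      exact pathClass_ne_zero_of_coeffs_ne_zero hI h hp
    rw [h0, h0, mul_zero]
  have he : pathClass I (QPath.trivial p.1) ≠ 0 :=
    pathClass_ne_zero_left (IsComp.trivial_left p) hp
  refine map_eq_map_of_coeffs hI (a := a)
    (f := Finsupp.lapply p ∘ₗ coeffs hI ∘ₗ LinearMap.mulRight k b)
    (g := LinearMap.mulRight k (coeffs hI b p) ∘ₗ Finsupp.lapply (QPath.trivial p.1) ∘ₗ coeffs hI)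
    fun u hu => ?_
  refine map_eq_map_of_coeffs hI (a := b)
    (f := Finsupp.lapply p ∘ₗ coeffs hI ∘ₗ LinearMap.mulLeft k (pathClass I u))
    (g := LinearMap.mulLeft k (coeffs hI (pathClass I u) (QPath.trivial p.1)) ∘ₗ
      Finsupp.lapply p ∘ₗ coeffs hI)
    fun q hq => ?_
  have hu' := pathClass_ne_zero_of_coeffs_ne_zero hI hu
  have hq' := pathClass_ne_zero_of_coeffs_ne_zero hI hq
  simp only [LinearMap.comp_apply, LinearMap.mulLeft_apply, Finsupp.lapply_apply]
  rw [coeffs_pathClass hI hu', coeffs_pathClass hI hq']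
  have hlen := hb q hq
  by_cases huq : u.2.1 = q.1
  · obtain ⟨r, hr⟩ := IsComp.exists_of_end_eq huq
    have hrl := hr.length_eq
    rw [pathClass_mul_of_isComp hr]
    by_cases hrp : r = p
    · subst hrp
      have h0 : u.length = 0 := by omega
      have hqr := IsComp.eq_of_trivial_left hr h0
      have hue : u = QPath.trivial r.1 := by
        rw [← hr.start_eq]
        exact IsComp.eq_trivial_of_length_eq_zero h0
      rw [coeffs_pathClass hI hp, hqr, hue, Finsupp.single_eq_same, Finsupp.single_eq_same,
        one_mul]
    · have h1 : coeffs hI (pathClass I r) p = 0 := by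
        by_cases h : pathClass I r = 0
        · rw [h, map_zero, Finsupp.zero_apply]
        · rw [coeffs_pathClass hI h, Finsupp.single_eq_of_ne (Ne.symm hrp)]
      rw [h1]
      by_cases hqp : q = p
      · subst hqp
        by_cases hue : u = QPath.trivial q.1
        · rw [hue] at hr
          exact absurd (hr.unique (IsComp.trivial_left q)) hrp
        · rw [Finsupp.single_eq_of_ne (Ne.symm hue), zero_mul]
      · rw [Finsupp.single_eq_of_ne (Ne.symm hqp), mul_zero]
  · rw [pathClass_mul_of_ne huq, map_zero, Finsupp.zero_apply]
    by_cases hqp : q = p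
    · subst hqp
      by_cases hue : u = QPath.trivial q.1
      · rw [hue] at huq
        exact absurd rfl huq
      · rw [Finsupp.single_eq_of_ne (Ne.symm hue), zero_mul]
    · rw [Finsupp.single_eq_of_ne (Ne.symm hqp), mul_zero]

theorem eq_of_coeffs_pathClass_ne_zero (hI : IsMonomial I) {p q : QPath V}
    (h : coeffs hI (pathClass I p) q ≠ 0) : q = p := by
  by_contra hqp
  by_cases hp : pathClass I p = 0
  · rw [hp, map_zero] at h
    exact h rfl
  · rw [coeffs_pathClass hI hp, Finsupp.single_eq_of_ne hqp] at h
    exact h rfl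

theorem coeffs_mul_pathClass_self (hI : IsMonomial I) (a : QuotAlg I) {p : QPath V}
    (hp : pathClass I p ≠ 0) :
    coeffs hI (a * pathClass I p) p = coeffs hI a (QPath.trivial p.1) := by
  rw [coeffs_mul_apply, coeffs_pathClass hI hp, Finsupp.single_eq_same, mul_one]
  intro q hq
  rw [eq_of_coeffs_pathClass_ne_zero hI hq]

/-! ### Projection to the paths with a given terminal segment -/

open Classical in
/-- The linear endomorphism of `kQ / I` which keeps the paths ending in `σ` and deletes all
others. -/
def suffixProj (hI : IsMonomial I) (σ : QPath V) : QuotAlg I →ₗ[k] QuotAlg I :=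
  Finsupp.linearCombination k (fun p => if IsSuffix σ p then pathClass I p else 0) ∘ₗ coeffs hI

theorem suffixProj_pathClass_of_isSuffix (hI : IsMonomial I) {σ p : QPath V}
    (h : IsSuffix σ p) : suffixProj hI σ (pathClass I p) = pathClass I p := by
  by_cases hp : pathClass I p = 0
  · rw [hp, map_zero]
  · rw [suffixProj, LinearMap.comp_apply, coeffs_pathClass hI hp,
      Finsupp.linearCombination_single, if_pos h, one_smul]

theorem suffixProj_pathClass_of_not_isSuffix (hI : IsMonomial I) {σ p : QPath V}
    (h : ¬ IsSuffix σ p) : suffixProj hI σ (pathClass I p) = 0 := by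
  by_cases hp : pathClass I p = 0
  · rw [hp, map_zero]
  · rw [suffixProj, LinearMap.comp_apply, coeffs_pathClass hI hp,
      Finsupp.linearCombination_single, if_neg h, smul_zero]

theorem coeffs_suffixProj_self (hI : IsMonomial I) (σ : QPath V) (a : QuotAlg I) :
    coeffs hI (suffixProj hI σ a) σ = coeffs hI a σ := by
  refine map_eq_map_of_coeffs hI (a := a)
    (f := Finsupp.lapply σ ∘ₗ coeffs hI ∘ₗ suffixProj hI σ)
    (g := Finsupp.lapply σ ∘ₗ coeffs hI) fun p hp => ?_
  have hp' := pathClass_ne_zero_of_coeffs_ne_zero hI hp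
  simp only [LinearMap.comp_apply, Finsupp.lapply_apply]
  by_cases h : IsSuffix σ p
  · rw [suffixProj_pathClass_of_isSuffix hI h]
  · rw [suffixProj_pathClass_of_not_isSuffix hI h, coeffs_pathClass hI hp', map_zero,
      Finsupp.zero_apply, Finsupp.single_eq_of_ne]
    rintro rfl
    exact h ⟨_, IsComp.trivial_left _⟩

/-- Left multiplication does not change the terminal segments of sufficiently long paths. -/
theorem suffixProj_mul (hI : IsMonomial I) (σ : QPath V) (a b : QuotAlg I)
    (hb : ∀ q, coeffs hI b q ≠ 0 → σ.length ≤ q.length) :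
    suffixProj hI σ (a * b) = a * suffixProj hI σ b := by
  refine map_eq_map_of_coeffs hI (a := a)
    (f := suffixProj hI σ ∘ₗ LinearMap.mulRight k b)
    (g := LinearMap.mulRight k (suffixProj hI σ b)) fun u _ => ?_
  refine map_eq_map_of_coeffs hI (a := b)
    (f := suffixProj hI σ ∘ₗ LinearMap.mulLeft k (pathClass I u))
    (g := LinearMap.mulLeft k (pathClass I u) ∘ₗ suffixProj hI σ) fun q hq => ?_
  have hlen := hb q hq
  simp only [LinearMap.comp_apply, LinearMap.mulLeft_apply]
  by_cases huq : u.2.1 = q.1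
  · obtain ⟨r, hr⟩ := IsComp.exists_of_end_eq huq
    rw [pathClass_mul_of_isComp hr]
    by_cases h : IsSuffix σ q
    · rw [suffixProj_pathClass_of_isSuffix hI h,
        suffixProj_pathClass_of_isSuffix hI ((hr.isSuffix_iff hlen).mpr h),
        pathClass_mul_of_isComp hr]
    · rw [suffixProj_pathClass_of_not_isSuffix hI h,
        suffixProj_pathClass_of_not_isSuffix hI (mt (hr.isSuffix_iff hlen).mp h), mul_zero]
  · rw [pathClass_mul_of_ne huq, map_zero]
    by_cases h : IsSuffix σ q
    · rw [suffixProj_pathClass_of_isSuffix hI h, pathClass_mul_of_ne huq]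
    · rw [suffixProj_pathClass_of_not_isSuffix hI h, mul_zero]

theorem exists_suffixProj_eq_mul (hI : IsMonomial I) (σ : QPath V) (a : QuotAlg I) :
    ∃ z : QuotAlg I, suffixProj hI σ a = z * pathClass I σ := by
  have hle : LinearMap.range (suffixProj hI σ) ≤
      LinearMap.range (LinearMap.mulRight k (pathClass I σ)) := by
    rintro _ ⟨a, rfl⟩
    rw [← linearCombination_coeffs hI a, Finsupp.linearCombination_apply, Finsupp.sum, map_sum]
    refine Submodule.sum_mem _ fun p _ => ?_
    rw [map_smul]
    refine Submodule.smul_mem _ _ ?_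
    by_cases h : IsSuffix σ p
    · obtain ⟨u, hu⟩ := h
      rw [suffixProj_pathClass_of_isSuffix hI ⟨u, hu⟩]
      exact ⟨pathClass I u, pathClass_mul_of_isComp hu⟩
    · rw [suffixProj_pathClass_of_not_isSuffix hI h]
      exact zero_mem _
  obtain ⟨z, hz⟩ := hle ⟨a, rfl⟩
  exact ⟨z, hz.symm⟩

/-! ### The right ideals generated by paths -/

theorem mem_pathIdeal {σ : QPath V} {b : QuotAlg I} :
    b ∈ pathIdeal I σ ↔ ∃ a, pathClass I σ * a = b := by
  rw [pathIdeal, Submodule.mem_span_singleton]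
  constructor
  · rintro ⟨a, rfl⟩
    exact ⟨a.unop, rfl⟩
  · rintro ⟨a, rfl⟩
    exact ⟨MulOpposite.op a, rfl⟩

theorem pathClass_mem_pathIdeal {σ p : QPath V} (h : IsPrefix σ p) :
    pathClass I p ∈ pathIdeal I σ := by
  obtain ⟨u, hu⟩ := h
  exact mem_pathIdeal.mpr ⟨_, pathClass_mul_of_isComp hu⟩

theorem isPrefix_of_coeffs_ne_zero (hI : IsMonomial I) {σ p : QPath V} {b : QuotAlg I}
    (hb : b ∈ pathIdeal I σ) (hp : coeffs hI b p ≠ 0) : IsPrefix σ p := by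
  obtain ⟨a, rfl⟩ := mem_pathIdeal.mp hb
  by_contra hc
  refine hp (map_eq_map_of_coeffs hI (a := a)
    (f := Finsupp.lapply p ∘ₗ coeffs hI ∘ₗ LinearMap.mulLeft k (pathClass I σ))
    (g := 0) fun q _ => ?_)
  simp only [LinearMap.comp_apply, LinearMap.mulLeft_apply, Finsupp.lapply_apply,
    LinearMap.zero_apply]
  by_cases h : σ.2.1 = q.1
  · obtain ⟨r, hr⟩ := IsComp.exists_of_end_eq h
    rw [pathClass_mul_of_isComp hr]
    by_cases h0 : pathClass I r = 0
    · rw [h0, map_zero, Finsupp.zero_apply]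
    · rw [coeffs_pathClass hI h0, Finsupp.single_eq_of_ne]
      rintro rfl
      exact hc ⟨q, hr⟩
  · rw [pathClass_mul_of_ne h, map_zero, Finsupp.zero_apply]

end PathAlgebra

/-! ### An order on the terms of a vector -/

namespace QPath

variable {V : Type v} [Quiver.{w} V]

/-- The sorting key of the term "path `p` in coordinate `j`" of a vector over `kQ / I`: short paths
come first, then small coordinates, and the remaining ties are broken by an arbitrary linear order
on the paths. -/
def termKey {m : ℕ} (j : Fin m) (p : QPath V) : ℕ ×ₗ (Fin m ×ₗ QPath V) :=
  toLex (p.length, toLex (j, p))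

theorem termKey_le_iff [LinearOrder (QPath V)] {m : ℕ} {j j' : Fin m} {p p' : QPath V} :
    termKey j p ≤ termKey j' p' ↔
      p.length < p'.length ∨ p.length = p'.length ∧ (j < j' ∨ j = j' ∧ p ≤ p') := by
  rw [termKey, termKey, Prod.Lex.toLex_le_toLex, Prod.Lex.toLex_le_toLex]

theorem length_le_of_termKey_le [LinearOrder (QPath V)] {m : ℕ} {j j' : Fin m} {p p' : QPath V}
    (h : termKey j p ≤ termKey j' p') : p.length ≤ p'.length := by
  rcases termKey_le_iff.mp h with h | h
  · exact h.le
  · exact h.1.le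

theorem termKey_injective {m : ℕ} {j j' : Fin m} {p p' : QPath V}
    (h : termKey j p = termKey j' p') : j = j' ∧ p = p' := by
  have h' := congrArg (fun x => ofLex (ofLex x).2) h
  exact ⟨congrArg Prod.fst h', congrArg Prod.snd h'⟩

end QPath

namespace PathAlgebra

open QPath

variable {k : Type u} {V : Type v} [Field k] [Quiver.{w} V] [Fintype V]
  {I : TwoSidedIdeal (PathAlgebra k V)}

/-! ### Leading terms of submodules of free modules -/

theorem finite_terms {m : ℕ} (hI : IsMonomial I) (y : Fin m → QuotAlg I) :
    {b : Fin m × QPath V | coeffs hI (y b.1) b.2 ≠ 0}.Finite := by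
  have h : (⋃ j : Fin m, Prod.mk j '' ((coeffs hI (y j)).support : Set (QPath V))).Finite :=
    Set.finite_iUnion fun j => (Finset.finite_toSet _).image _
  refine h.subset fun b hb => Set.mem_iUnion.mpr ⟨b.1, b.2, ?_, rfl⟩
  exact Finsupp.mem_support_iff.mpr hb

/-- The map `⨁ σ i A → A ^ m` given by left multiplication with vectors `z i`. -/
def sumMul {m : ℕ} {ι : Type*} [Fintype ι] (σ : ι → QPath V) (z : ι → Fin m → QuotAlg I) :
    ((i : ι) → pathIdeal I (σ i)) →ₗ[(QuotAlg I)ᵐᵒᵖ] (Fin m → QuotAlg I) where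
  toFun b j := ∑ i, z i j * (b i : QuotAlg I)
  map_add' b c := by
    funext j
    simp only [Pi.add_apply, Submodule.coe_add, mul_add, Finset.sum_add_distrib]
  map_smul' a b := by
    funext j
    simp only [Pi.smul_apply, RingHom.id_apply]
    rw [← MulOpposite.op_unop a, op_smul_eq_mul, Finset.sum_mul]
    refine Finset.sum_congr rfl fun i _ => ?_
    rw [mul_assoc]
    rfl

theorem sumMul_apply {m : ℕ} {ι : Type*} [Fintype ι] (σ : ι → QPath V) (z : ι → Fin m → QuotAlg I)
    (b : (i : ι) → pathIdeal I (σ i)) (j : Fin m) :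
    sumMul σ z b j = ∑ i, z i j * (b i : QuotAlg I) := rfl

/-- The submodule `L` contains, with any vector whose terms are all at least as long as `σ`, the
part of this vector consisting of the terms which end in `σ`. -/
def SuffixClosed {m : ℕ} (hI : IsMonomial I)
    (L : Submodule (QuotAlg I)ᵐᵒᵖ (Fin m → QuotAlg I)) : Prop :=
  ∀ y ∈ L, ∀ σ, (∀ j q, coeffs hI (y j) q ≠ 0 → σ.length ≤ q.length) →
    (fun j => suffixProj hI σ (y j)) ∈ L


section Tips

variable [LinearOrder (QPath V)] {m : ℕ}

/-- The term `(j, τ)` is the first one of the vector `y`. -/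
def IsTip (hI : IsMonomial I) (y : Fin m → QuotAlg I) (j : Fin m) (τ : QPath V) : Prop :=
  coeffs hI (y j) τ ≠ 0 ∧ ∀ j' p, coeffs hI (y j') p ≠ 0 → termKey j τ ≤ termKey j' p

theorem exists_isTip (hI : IsMonomial I) {y : Fin m → QuotAlg I} (hy : y ≠ 0) :
    ∃ j τ, IsTip hI y j τ := by
  have hne : {b : Fin m × QPath V | coeffs hI (y b.1) b.2 ≠ 0}.Nonempty := by
    by_contra h
    rw [Set.not_nonempty_iff_eq_empty] at h
    refine hy (funext fun j => coeffs_injective hI ?_)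
    ext p
    rw [Pi.zero_apply, map_zero, Finsupp.zero_apply]
    by_contra hp
    have : ((j, p) : Fin m × QPath V) ∈ (∅ : Set (Fin m × QPath V)) := h ▸ hp
    exact this
  obtain ⟨b, hb, hmin⟩ := Set.exists_min_image _ (fun b => termKey b.1 b.2) (finite_terms hI y) hne
  exact ⟨b.1, b.2, hb, fun j' p hp => hmin (j', p) hp⟩

variable (hI : IsMonomial I) (L : Submodule (QuotAlg I)ᵐᵒᵖ (Fin m → QuotAlg I))

/-- The term `(j, τ)` is the first one of some element of `L`. -/
def IsTipOf (j : Fin m) (τ : QPath V) : Prop := ∃ y ∈ L, IsTip hI y j τ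

/-- The term `(j, τ)` is the first one of some element of `L`, and `τ` has no proper initial
segment with this property in the same coordinate. -/
def IsMinTip (j : Fin m) (τ : QPath V) : Prop :=
  IsTipOf hI L j τ ∧ ∀ σ, IsPrefix σ τ → IsTipOf hI L j σ → σ = τ

variable {hI L}

theorem IsTipOf.pathClass_ne_zero {j : Fin m} {τ : QPath V} (h : IsTipOf hI L j τ) :
    pathClass I τ ≠ 0 := by
  obtain ⟨y, -, hy⟩ := h
  exact pathClass_ne_zero_of_coeffs_ne_zero hI hy.1

theorem IsTipOf.exists_isMinTip {j : Fin m} {τ : QPath V} (h : IsTipOf hI L j τ) :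
    ∃ σ, IsPrefix σ τ ∧ IsMinTip hI L j σ := by
  classical
  have hex : ∃ n σ, IsPrefix σ τ ∧ IsTipOf hI L j σ ∧ σ.length = n :=
    ⟨_, τ, isPrefix_refl τ, h, rfl⟩
  obtain ⟨σ, hσ, hσ', hn⟩ := Nat.find_spec hex
  refine ⟨σ, hσ, hσ', fun ρ hρ hρ' => ?_⟩
  have hle : Nat.find hex ≤ ρ.length := Nat.find_min' hex ⟨ρ, hρ.trans hσ, hρ', rfl⟩
  exact hρ.eq_of_length_eq (isPrefix_refl σ) (le_antisymm hρ.length_le (hn ▸ hle))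

/-- An element of a suffix-closed `L` with first term `(j, σ)` may be replaced by one of the form
`z * σ`, and then left multiplication by `z` maps `σ A` to `L` without disturbing first terms. -/
theorem SuffixClosed.exists_vector (hL : SuffixClosed hI L) {j : Fin m} {σ : QPath V}
    (h : IsTipOf hI L j σ) :
    ∃ z : Fin m → QuotAlg I, (∀ b ∈ pathIdeal I σ, (fun i => z i * b) ∈ L) ∧
      coeffs hI (z j) (QPath.trivial σ.1) ≠ 0 ∧
      ∀ j' < j, coeffs hI (z j') (QPath.trivial σ.1) = 0 := by
  have hσ := h.pathClass_ne_zero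
  obtain ⟨y, hy, hy1, hy2⟩ := h
  choose z hz using fun i => exists_suffixProj_eq_mul hI σ (y i)
  have hcoef (i : Fin m) : coeffs hI (z i) (QPath.trivial σ.1) = coeffs hI (y i) σ := by
    rw [← coeffs_suffixProj_self hI σ (y i), hz, coeffs_mul_pathClass_self hI _ hσ]
  refine ⟨z, fun b hb => ?_, ?_, fun j' hj' => ?_⟩
  · obtain ⟨a, rfl⟩ := mem_pathIdeal.mp hb
    have hmem := L.smul_mem (MulOpposite.op a)
      (hL y hy σ fun j' q hq => length_le_of_termKey_le (hy2 j' q hq))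
    convert hmem using 1
    funext i
    rw [Pi.smul_apply, hz, ← mul_assoc]
    rfl
  · rw [hcoef]
    exact hy1
  · rw [hcoef]
    by_contra hc
    rcases termKey_le_iff.mp (hy2 j' σ hc) with h | ⟨-, h | h⟩
    · exact lt_irrefl _ h
    · exact lt_asymm h hj'
    · exact hj'.ne h.1.symm

/-- Multiplying `τ` by a vector without the trivial path at the start of `τ` in the coordinates
before `j` creates no term before `(j, τ)`. -/
theorem termKey_le_of_coeffs_mul_ne_zero {z : Fin m → QuotAlg I} {j : Fin m} {τ : QPath V}
    (hτ : pathClass I τ ≠ 0) (hz : ∀ j' < j, coeffs hI (z j') (QPath.trivial τ.1) = 0)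
    {j' : Fin m} {p : QPath V} (h : coeffs hI (z j' * pathClass I τ) p ≠ 0) :
    termKey j τ ≤ termKey j' p := by
  rw [termKey_le_iff]
  by_cases hlt : τ.length < p.length
  · exact Or.inl hlt
  rw [coeffs_mul_apply, coeffs_pathClass hI hτ] at h
  · by_cases hp : p = τ
    · subst hp
      refine Or.inr ⟨rfl, ?_⟩
      rcases lt_trichotomy j j' with hj | hj | hj
      · exact Or.inl hj
      · exact Or.inr ⟨hj, le_rfl⟩
      · rw [hz j' hj, zero_mul] at h
        exact absurd rfl h
    · rw [Finsupp.single_eq_of_ne hp, mul_zero] at h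
      exact absurd rfl h
  · intro q hq
    rw [eq_of_coeffs_pathClass_ne_zero hI hq]
    exact not_lt.mp hlt

/-- If the first terms of the vectors `z i` sit in the coordinates `j i`, and no two different
`(j i, σ i)` have a common extension, then first terms cannot cancel. -/
theorem sumMul_injective {ι : Type*} [Fintype ι] {σ : ι → QPath V} {z : ι → Fin m → QuotAlg I}
    {j : ι → Fin m} (hz : ∀ i, coeffs hI (z i (j i)) (QPath.trivial (σ i).1) ≠ 0)
    (hz' : ∀ i, ∀ j' < j i, coeffs hI (z i j') (QPath.trivial (σ i).1) = 0)
    (hσ : ∀ i i' p, j i = j i' → IsPrefix (σ i) p → IsPrefix (σ i') p → i = i') :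
    Function.Injective (sumMul σ z) := by
  rw [injective_iff_map_eq_zero]
  intro b hb
  by_contra hne
  have hfin : {x : ι × QPath V | coeffs hI (b x.1 : QuotAlg I) x.2 ≠ 0}.Finite := by
    have h : (⋃ i : ι,
        Prod.mk i '' ((coeffs hI (b i : QuotAlg I)).support : Set (QPath V))).Finite :=
      Set.finite_iUnion fun j => (Finset.finite_toSet _).image _
    refine h.subset fun x hx => Set.mem_iUnion.mpr ⟨x.1, x.2, ?_, rfl⟩
    exact Finsupp.mem_support_iff.mpr hx
  have hnon : {x : ι × QPath V | coeffs hI (b x.1 : QuotAlg I) x.2 ≠ 0}.Nonempty := by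
    by_contra h
    rw [Set.not_nonempty_iff_eq_empty] at h
    refine hne (funext fun i => Subtype.ext (coeffs_injective hI ?_))
    ext p
    rw [Pi.zero_apply, Submodule.coe_zero, map_zero, Finsupp.zero_apply]
    by_contra hp
    have : ((i, p) : ι × QPath V) ∈ (∅ : Set (ι × QPath V)) := h ▸ hp
    exact this
  obtain ⟨⟨i, p⟩, hip, hmin⟩ :=
    Set.exists_min_image _ (fun x => termKey (j x.1) x.2) hfin hnon
  have hlen (i' : ι) (q : QPath V) (hq : coeffs hI (b i' : QuotAlg I) q ≠ 0) :
      p.length ≤ q.length := length_le_of_termKey_le (hmin (i', q) hq)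
  have hpre := isPrefix_of_coeffs_ne_zero hI (b i).2 hip
  have h0 : coeffs hI (sumMul σ z b (j i)) p = 0 := by
    rw [hb, Pi.zero_apply, map_zero, Finsupp.zero_apply]
  rw [sumMul_apply, map_sum, Finsupp.finsetSum_apply, Finset.sum_eq_single i] at h0
  · rw [coeffs_mul_apply hI _ _ _ (hlen i), ← hpre.start_eq] at h0
    exact mul_ne_zero (hz i) hip h0
  · intro i' _ hi'
    rw [coeffs_mul_apply hI _ _ _ (hlen i')]
    by_cases hi'p : coeffs hI (b i' : QuotAlg I) p = 0
    · rw [hi'p, mul_zero]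
    · have hpre' := isPrefix_of_coeffs_ne_zero hI (b i').2 hi'p
      rcases termKey_le_iff.mp (hmin (i', p) hi'p) with h | ⟨-, h | h⟩
      · exact absurd h (lt_irrefl _)
      · rw [← hpre'.start_eq, hz' i' _ h, zero_mul]
      · exact absurd (hσ i i' p h.1 hpre hpre').symm hi'
  · intro h
    exact absurd (Finset.mem_univ i) h

/-- A suffix-closed submodule of `A ^ m` is a finite direct sum of right ideals generated by
paths: one for each minimal first term. -/
theorem SuffixClosed.exists_equiv [∀ a b : V, Finite (a ⟶ b)] [IsAdmissible I]
    (hL : SuffixClosed hI L) :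
    ∃ (ι : Type (max v w)) (_ : Fintype ι) (σ : ι → QPath V), (∀ i, pathClass I (σ i) ≠ 0) ∧
      Nonempty (L ≃ₗ[(QuotAlg I)ᵐᵒᵖ] ((i : ι) → pathIdeal I (σ i))) := by
  let ι := {b : Fin m × QPath V // IsMinTip hI L b.1 b.2}
  have hfin : {b : Fin m × QPath V | pathClass I b.2 ≠ 0}.Finite := by
    refine (Set.finite_univ.prod (finite_pathClass_ne_zero I)).subset ?_
    exact fun b hb => ⟨Set.mem_univ _, hb⟩
  have : Finite ι := (hfin.subset fun b hb => hb.1.pathClass_ne_zero).to_subtype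
  let _ : Fintype ι := Fintype.ofFinite ι
  choose z hzL hz hz' using fun i : ι => hL.exists_vector i.2.1
  have hinj : Function.Injective (sumMul (fun i : ι => i.1.2) z) := by
    refine sumMul_injective (j := fun i => i.1.1) hz hz' fun i i' p hj hp hp' => ?_
    obtain ⟨⟨j, σ⟩, hσ⟩ := i
    obtain ⟨⟨j', σ'⟩, hσ'⟩ := i'
    obtain rfl : j = j' := hj
    rcases le_total σ.length σ'.length with hl | hl
    · obtain rfl := hσ'.2 σ (hp.of_length_le hp' hl) hσ.1
      rfl
    · obtain rfl := hσ.2 σ' (hp'.of_length_le hp hl) hσ'.1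
      rfl
  have hrange : LinearMap.range (sumMul (fun i : ι => i.1.2) z) = L := by
    apply le_antisymm
    · rintro _ ⟨b, rfl⟩
      have h : sumMul (fun i : ι => i.1.2) z b = ∑ i, fun j => z i j * (b i : QuotAlg I) := by
        funext j
        rw [sumMul_apply, Finset.sum_apply]
      rw [h]
      exact Submodule.sum_mem _ fun i _ => hzL i _ (b i).2
    · by_contra hnot
      obtain ⟨y₀, hy₀, hy₀'⟩ := SetLike.not_le_iff_exists.mp hnot
      -- An element of `L` outside the range whose first term is as late as possible.
      let T : Set (Fin m × QPath V) := {b | ∃ y ∈ L,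
        y ∉ LinearMap.range (sumMul (fun i : ι => i.1.2) z) ∧ IsTip hI y b.1 b.2}
      have hT : T.Finite :=
        hfin.subset fun b ⟨y, _, _, hy⟩ => pathClass_ne_zero_of_coeffs_ne_zero hI hy.1
      have hT' : T.Nonempty := by
        obtain ⟨j, τ, h⟩ := exists_isTip hI (y := y₀) (by rintro rfl; exact hy₀' (zero_mem _))
        exact ⟨(j, τ), y₀, hy₀, hy₀', h⟩
      obtain ⟨⟨j, τ⟩, ⟨y, hyL, hy, htip⟩, hmax⟩ :=
        Set.exists_max_image T (fun b => termKey b.1 b.2) hT hT'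
      have hτ : pathClass I τ ≠ 0 := pathClass_ne_zero_of_coeffs_ne_zero hI htip.1
      obtain ⟨σ, hστ, hσ⟩ := IsTipOf.exists_isMinTip (hI := hI) (L := L) ⟨y, hyL, htip⟩
      let i : ι := ⟨(j, σ), hσ⟩
      have hzi : coeffs hI (z i j) (QPath.trivial τ.1) ≠ 0 := hστ.start_eq ▸ hz i
      have hzi' : ∀ j' < j, coeffs hI (z i j') (QPath.trivial τ.1) = 0 := hστ.start_eq ▸ hz' i
      have hlead : coeffs hI (z i j * pathClass I τ) τ =
          coeffs hI (z i j) (QPath.trivial τ.1) := coeffs_mul_pathClass_self hI _ hτ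
      -- Subtracting a multiple of `z i * τ` cancels the first term of `y`.
      let c : k := coeffs hI (y j) τ / coeffs hI (z i j) (QPath.trivial τ.1)
      have hmemI : c • pathClass I τ ∈ pathIdeal I σ := by
        obtain ⟨a, ha⟩ := mem_pathIdeal.mp (pathClass_mem_pathIdeal (I := I) hστ)
        rw [← ha, ← mul_smul_comm]
        exact mem_pathIdeal.mpr ⟨_, rfl⟩
      let y' : Fin m → QuotAlg I := y - fun l => z i l * (c • pathClass I τ)
      have hy'L : y' ∈ L := L.sub_mem hyL (hzL i _ hmemI)
      have hy' : y' ∉ LinearMap.range (sumMul (fun i : ι => i.1.2) z) := by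
        intro h
        refine hy ?_
        have hadd : y = y' + fun l => z i l * (c • pathClass I τ) := (sub_add_cancel _ _).symm
        rw [hadd]
        refine Submodule.add_mem _ h ⟨Pi.single i ⟨_, hmemI⟩, ?_⟩
        funext l
        rw [sumMul_apply, Finset.sum_eq_single i, Pi.single_eq_same]
        · intro i' _ hi'
          rw [Pi.single_eq_of_ne hi', Submodule.coe_zero, mul_zero]
        · intro h
          exact absurd (Finset.mem_univ i) h
      have hcoef (l : Fin m) (p : QPath V) : coeffs hI (y' l) p =
          coeffs hI (y l) p - c * coeffs hI (z i l * pathClass I τ) p := by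
        change coeffs hI (y l - z i l * (c • pathClass I τ)) p = _
        rw [mul_smul_comm, map_sub, map_smul, Finsupp.sub_apply, Finsupp.smul_apply, smul_eq_mul]
      obtain ⟨j', τ', htip'⟩ := exists_isTip hI (y := y') (by
        intro h
        rw [h] at hy'
        exact hy' (zero_mem _))
      have hle : termKey j τ ≤ termKey j' τ' := by
        have h := htip'.1
        rw [hcoef] at h
        by_cases h1 : coeffs hI (y j') τ' = 0
        · refine termKey_le_of_coeffs_mul_ne_zero hτ hzi' (fun h2 => h ?_)
          rw [h1, h2, mul_zero, sub_zero]
        · exact htip.2 _ _ h1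
      obtain ⟨rfl, rfl⟩ := termKey_injective
        (le_antisymm hle (hmax (j', τ') ⟨y', hy'L, hy', htip'⟩))
      refine htip'.1 ?_
      rw [hcoef, hlead]
      exact sub_eq_zero.mpr (div_mul_cancel₀ _ hzi).symm
  exact ⟨ι, inferInstance, fun i => i.1.2, fun i => i.2.1.pathClass_ne_zero,
    ⟨((LinearEquiv.ofInjective _ hinj).trans (LinearEquiv.ofEq _ _ hrange)).symm⟩⟩

end Tips

/-! ### Kernels of maps between free modules -/

theorem apply_eq_sum_mul {m n : ℕ}
    (g : (Fin m → QuotAlg I) →ₗ[(QuotAlg I)ᵐᵒᵖ] (Fin n → QuotAlg I)) (y : Fin m → QuotAlg I)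
    (i : Fin n) : g y i = ∑ j, g (Pi.single j 1) i * y j := by
  have hy : y = ∑ j, MulOpposite.op (y j) • (Pi.single j 1 : Fin m → QuotAlg I) := by
    funext l
    rw [Finset.sum_apply, Finset.sum_eq_single l]
    · rw [Pi.smul_apply, Pi.single_eq_same, op_smul_eq_mul, one_mul]
    · intro j _ hj
      rw [Pi.smul_apply, Pi.single_eq_of_ne (Ne.symm hj), smul_zero]
    · intro h
      exact absurd (Finset.mem_univ l) h
  conv_lhs => rw [hy, map_sum, Finset.sum_apply]
  refine Finset.sum_congr rfl fun j _ => ?_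
  rw [map_smul, Pi.smul_apply, op_smul_eq_mul]

/-- A map between free right modules is left multiplication by a matrix, so it commutes with the
projection to the paths ending in `σ` on vectors without terms shorter than `σ`. -/
theorem suffixClosed_ker (hI : IsMonomial I) {m n : ℕ}
    (g : (Fin m → QuotAlg I) →ₗ[(QuotAlg I)ᵐᵒᵖ] (Fin n → QuotAlg I)) :
    SuffixClosed hI (LinearMap.ker g) := by
  intro y hy σ hσ
  rw [LinearMap.mem_ker] at hy ⊢
  funext i
  have h : suffixProj hI σ (g y i) = 0 := by rw [hy, Pi.zero_apply, map_zero]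
  rw [apply_eq_sum_mul, map_sum] at h
  rw [apply_eq_sum_mul, Pi.zero_apply, ← h]
  exact Finset.sum_congr rfl fun j _ => (suffixProj_mul hI σ _ _ (hσ j)).symm

/-- The kernel of a map between free modules over a monomial algebra is a finite direct sum of
right ideals generated by paths. -/
theorem exists_ker_equiv_pi_pathIdeal [∀ a b : V, Finite (a ⟶ b)] [IsAdmissible I]
    (hI : IsMonomial I) {m n : ℕ}
    (g : (Fin m → QuotAlg I) →ₗ[(QuotAlg I)ᵐᵒᵖ] (Fin n → QuotAlg I)) :
    ∃ (ι : Type (max v w)) (_ : Fintype ι) (σ : ι → QPath V), (∀ i, pathClass I (σ i) ≠ 0) ∧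
      Nonempty (LinearMap.ker g ≃ₗ[(QuotAlg I)ᵐᵒᵖ] ((i : ι) → pathIdeal I (σ i))) := by
  classical
  let _ : LinearOrder (QPath V) := linearOrderOfSTO WellOrderingRel
  exact (suffixClosed_ker hI g).exists_equiv

/-! ### Indecomposability and projectivity -/

theorem projective_pathIdeal_trivial (a : V) :
    Module.Projective (QuotAlg I)ᵐᵒᵖ (pathIdeal I (QPath.trivial a)) := by
  have hid : pathClass I (QPath.trivial a) * pathClass I (QPath.trivial a) =
      pathClass I (QPath.trivial a) :=
    pathClass_mul_of_isComp (IsComp.trivial_left (QPath.trivial a))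
  let e : (QuotAlg I)ᵐᵒᵖ →ₗ[(QuotAlg I)ᵐᵒᵖ] pathIdeal I (QPath.trivial a) :=
    { toFun := fun x => ⟨pathClass I (QPath.trivial a) * x.unop, mem_pathIdeal.mpr ⟨_, rfl⟩⟩
      map_add' := fun x y => Subtype.ext (by
        simp only [MulOpposite.unop_add, mul_add, Submodule.coe_add])
      map_smul' := fun c x => Subtype.ext (by
        simp only [smul_eq_mul, MulOpposite.unop_mul, ← mul_assoc]
        rfl) }
  let s : pathIdeal I (QPath.trivial a) →ₗ[(QuotAlg I)ᵐᵒᵖ] (QuotAlg I)ᵐᵒᵖ :=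
    { toFun := fun x => MulOpposite.op x.1
      map_add' := fun x y => rfl
      map_smul' := fun c x => rfl }
  refine Module.Projective.of_split s e (LinearMap.ext fun x => Subtype.ext ?_)
  obtain ⟨y, hy⟩ := mem_pathIdeal.mp x.2
  change pathClass I (QPath.trivial a) * x.1 = x.1
  rw [← hy, ← mul_assoc, hid]

/-- An element of `σ A` in which `σ` itself occurs generates `σ A`. -/
theorem eq_top_of_coeffs_ne_zero [∀ a b : V, Finite (a ⟶ b)] [IsAdmissible I]
    (hI : IsMonomial I) {σ : QPath V} (X : Submodule (QuotAlg I)ᵐᵒᵖ (pathIdeal I σ))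
    {x : pathIdeal I σ} (hx : x ∈ X) (hσ : coeffs hI (x : QuotAlg I) σ ≠ 0) : X = ⊤ := by
  let Y : Submodule (QuotAlg I)ᵐᵒᵖ (QuotAlg I) := X.map (pathIdeal I σ).subtype
  have hxY : (x : QuotAlg I) ∈ Y := ⟨x, hx, rfl⟩
  have hY {a b : QuotAlg I} (ha : a ∈ Y) : a * b ∈ Y := Y.smul_mem (MulOpposite.op b) ha
  have hYk {a : QuotAlg I} (c : k) (ha : a ∈ Y) : c • a ∈ Y := by
    rw [← mul_one a, ← mul_smul_comm]
    exact hY ha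
  -- With `x = c σ + (longer paths)`, a path `σ t` is `c⁻¹ x t` up to longer paths of the same kind.
  -- The paths starting with `σ` therefore lie in `Y`, by descending induction on their length.
  have hpaths : ∀ p, IsPrefix σ p → pathClass I p ∈ Y := by
    classical
    by_contra! hc
    obtain ⟨p₀, hp₀, hp₀'⟩ := hc
    obtain ⟨p, ⟨hp, hpY⟩, hmax⟩ := Set.exists_max_image
      {p : QPath V | IsPrefix σ p ∧ pathClass I p ∉ Y} QPath.length
      ((finite_pathClass_ne_zero I).subset fun p hp h => hp.2 (h ▸ Y.zero_mem)) ⟨p₀, hp₀, hp₀'⟩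
    obtain ⟨t, ht⟩ := hp
    refine hpY ?_
    have hxe : (x : QuotAlg I) - coeffs hI (x : QuotAlg I) σ • pathClass I σ =
        ∑ q ∈ (coeffs hI (x : QuotAlg I)).support.erase σ,
          coeffs hI (x : QuotAlg I) q • pathClass I q := by
      rw [sub_eq_iff_eq_add', Finset.add_sum_erase _
        (fun q => coeffs hI (x : QuotAlg I) q • pathClass I q) (Finsupp.mem_support_iff.mpr hσ)]
      exact (linearCombination_coeffs hI (x : QuotAlg I)).symm
    have hrest : ((x : QuotAlg I) - coeffs hI (x : QuotAlg I) σ • pathClass I σ) *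
        pathClass I t ∈ Y := by
      rw [hxe, Finset.sum_mul]
      refine Submodule.sum_mem _ fun q hq => ?_
      rw [Finset.mem_erase, Finsupp.mem_support_iff] at hq
      rw [smul_mul_assoc]
      refine hYk _ ?_
      by_cases hqt : q.2.1 = t.1
      · obtain ⟨r, hr⟩ := IsComp.exists_of_end_eq hqt
        rw [pathClass_mul_of_isComp hr]
        have hpre := isPrefix_of_coeffs_ne_zero hI x.2 hq.2
        by_contra hrY
        have hle := hmax r ⟨hpre.trans ⟨t, hr⟩, hrY⟩
        have h1 := hr.length_eq
        have h2 := ht.length_eq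
        refine hq.1 (hpre.eq_of_length_eq (isPrefix_refl q) ?_).symm
        have := hpre.length_le
        omega
      · rw [pathClass_mul_of_ne hqt]
        exact Y.zero_mem
    have h1 := Y.sub_mem (hY (b := pathClass I t) hxY) hrest
    rw [← sub_mul, sub_sub_cancel, smul_mul_assoc, pathClass_mul_of_isComp ht] at h1
    have h2 := hYk (coeffs hI (x : QuotAlg I) σ)⁻¹ h1
    rwa [inv_smul_smul₀ hσ] at h2
  rw [eq_top_iff]
  rintro ⟨b, hb⟩ -
  obtain ⟨a, rfl⟩ := mem_pathIdeal.mp hb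
  obtain ⟨x', hx', hx''⟩ := hY (b := a) (hpaths σ (isPrefix_refl σ))
  have : x' = ⟨pathClass I σ * a, hb⟩ := Subtype.ext hx''
  rwa [this] at hx'

/-- The right ideal generated by a nonzero path is indecomposable, because it is local. -/
theorem isIndecomposable_pathIdeal [∀ a b : V, Finite (a ⟶ b)] [IsAdmissible I]
    (hI : IsMonomial I) {σ : QPath V} (hσ : pathClass I σ ≠ 0) :
    IgusaTodorov.IsIndecomposable
      (FGModuleCat.of (QuotAlg I)ᵐᵒᵖ (pathIdeal I σ) : FGModuleCat.{max u v w} _) := by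
  have hmem : pathClass I σ ∈ pathIdeal I σ := pathClass_mem_pathIdeal (isPrefix_refl σ)
  refine ⟨⟨⟨⟨_, hmem⟩, 0, fun h => hσ (congrArg Subtype.val h)⟩⟩, fun X Y hXY => ?_⟩
  change Submodule (QuotAlg I)ᵐᵒᵖ (pathIdeal I σ) at X Y
  obtain ⟨x, hx, y, hy, hxy⟩ := Submodule.mem_sup.mp
    (hXY.sup_eq_top ▸ Submodule.mem_top : (⟨_, hmem⟩ : pathIdeal I σ) ∈ X ⊔ Y)
  have hxy' : (x : QuotAlg I) + (y : QuotAlg I) = pathClass I σ := congrArg Subtype.val hxy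
  have hsum : coeffs hI (x : QuotAlg I) σ + coeffs hI (y : QuotAlg I) σ = 1 := by
    rw [← Finsupp.add_apply, ← map_add, hxy', coeffs_pathClass hI hσ, Finsupp.single_eq_same]
  by_cases h : coeffs hI (x : QuotAlg I) σ = 0
  · left
    rw [h, zero_add] at hsum
    have hY := eq_top_of_coeffs_ne_zero hI Y hy (by rw [hsum]; exact one_ne_zero)
    rw [hY] at hXY
    exact eq_bot_of_isCompl_top hXY
  · right
    rw [eq_top_of_coeffs_ne_zero hI X hx h] at hXY
    exact eq_bot_of_top_isCompl hXY

end PathAlgebra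

namespace IgusaTodorov

variable {R : Type u} [Ring R]

/-! ### Indecomposable summands -/

/-- Fitting's lemma. -/
theorem IsIndecomposable.isUnit_or_isNilpotent [IsArtinianRing R] {N : FGModuleCat.{u} R}
    (hN : IsIndecomposable N) (f : Module.End R N) : IsUnit f ∨ IsNilpotent f := by
  obtain ⟨n, hn⟩ := Filter.eventually_atTop.mp (LinearMap.eventually_isCompl_ker_pow_range_pow f)
  have hc := hn (n + 1) (Nat.le_succ n)
  rcases hN.2 _ _ hc with h | h
  · left
    rw [h] at hc
    have hu : IsUnit (f ^ (n + 1)) := (Module.End.isUnit_iff _).mpr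
      ⟨LinearMap.ker_eq_bot.mp h, LinearMap.range_eq_top.mp (eq_top_of_bot_isCompl hc)⟩
    exact (isUnit_pow_iff (Nat.succ_ne_zero n)).mp hu
  · exact Or.inr ⟨n + 1, LinearMap.range_eq_bot.mp h⟩

theorem IsIndecomposable.isLocalRing_end [IsArtinianRing R] {N : FGModuleCat.{u} R}
    (hN : IsIndecomposable N) : IsLocalRing (Module.End R N) := by
  have := hN.1
  refine IsLocalRing.of_isUnit_or_isUnit_one_sub_self fun f => ?_
  rcases hN.isUnit_or_isNilpotent f with h | h
  · exact Or.inl h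
  · exact Or.inr h.isUnit_one_sub

theorem exists_isUnit_of_isUnit_sum {S ι : Type*} [Semiring S] [IsLocalRing S] (s : Finset ι)
    (f : ι → S) (h : IsUnit (∑ i ∈ s, f i)) : ∃ i ∈ s, IsUnit (f i) := by
  classical
  induction s using Finset.induction_on with
  | empty =>
    rw [Finset.sum_empty] at h
    exact absurd h not_isUnit_zero
  | insert a s ha ih =>
    rw [Finset.sum_insert ha] at h
    rcases IsLocalRing.isUnit_or_isUnit_of_isUnit_add h with h | h
    · exact ⟨a, Finset.mem_insert_self _ _, h⟩
    · obtain ⟨i, hi, hi'⟩ := ih h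
      exact ⟨i, Finset.mem_insert_of_mem hi, hi'⟩

theorem isCompl_range_ker {M N : Type*} [AddCommGroup M] [Module R M] [AddCommGroup N] [Module R N]
    {f : N →ₗ[R] M} {g : M →ₗ[R] N} (h : g ∘ₗ f = LinearMap.id) :
    IsCompl (LinearMap.range f) (LinearMap.ker g) := by
  have hgf (x : N) : g (f x) = x := LinearMap.congr_fun h x
  constructor
  · rw [Submodule.disjoint_def]
    rintro _ ⟨x, rfl⟩ hx
    rw [LinearMap.mem_ker, hgf] at hx
    rw [hx, map_zero]
  · rw [codisjoint_iff, eq_top_iff]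
    intro x _
    refine Submodule.mem_sup.mpr ⟨f (g x), ⟨g x, rfl⟩, x - f (g x), ?_, add_sub_cancel _ _⟩
    rw [LinearMap.mem_ker, map_sub, hgf, sub_self]

/-- A retract of an indecomposable module is zero or the whole module. -/
theorem IsIndecomposable.nonempty_equiv_of_retract {M N : FGModuleCat.{u} R}
    (hM : IsIndecomposable M) [Nontrivial N] {f : N →ₗ[R] M} {g : M →ₗ[R] N}
    (h : g ∘ₗ f = LinearMap.id) : Nonempty (M ≃ₗ[R] N) := by
  have hgf (x : N) : g (f x) = x := LinearMap.congr_fun h x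
  rcases hM.2 _ _ (isCompl_range_ker h) with hr | hk
  · obtain ⟨x, hx⟩ := exists_ne (0 : N)
    refine absurd ?_ hx
    rw [← hgf x, LinearMap.range_eq_bot.mp hr, LinearMap.zero_apply, map_zero]
  · exact ⟨LinearEquiv.ofBijective g ⟨LinearMap.ker_eq_bot.mp hk, fun x => ⟨f x, hgf x⟩⟩⟩

theorem isSummand_of_retract {M N : FGModuleCat.{u} R} [IsArtinianRing R] {f : N →ₗ[R] M}
    {g : M →ₗ[R] N} (h : g ∘ₗ f = LinearMap.id) : IsSummand N M := by
  have e := lequivProdOfRightSplitExact (f := f) (g := g) (j := (LinearMap.ker g).subtype)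
    (Submodule.injective_subtype _) (Submodule.range_subtype _) h
  exact ⟨FGModuleCat.of R (LinearMap.ker g), ⟨e.symm.trans (LinearEquiv.prodComm R _ _)⟩⟩

open scoped DirectSum in
/-- An indecomposable direct summand of a finite direct sum of indecomposable modules is isomorphic
to one of them. -/
theorem exists_equiv_of_isSummand_directSum [IsArtinianRing R] {ι : Type*} [Finite ι]
    {X : ι → FGModuleCat.{u} R} (hX : ∀ i, IsIndecomposable (X i)) {M N : FGModuleCat.{u} R}
    (e : M ≃ₗ[R] ⨁ i, X i) (hN : IsIndecomposable N) (h : IsSummand N M) :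
    ∃ i, Nonempty (X i ≃ₗ[R] N) := by
  classical
  have := Fintype.ofFinite ι
  have := hN.isLocalRing_end
  have := hN.1
  obtain ⟨N', ⟨e'⟩⟩ := h
  -- The identity of `N` is the sum of the endomorphisms factoring through the `X i`; as `End N` is
  -- local, one of these is invertible, and it makes `N` a retract of `X i`.
  let a (i : ι) : N →ₗ[R] X i :=
    DirectSum.component R ι (fun i => X i) i ∘ₗ e.toLinearMap ∘ₗ e'.symm.toLinearMap ∘ₗ
      LinearMap.inl R N N'
  let b (i : ι) : X i →ₗ[R] N :=
    LinearMap.fst R N N' ∘ₗ e'.toLinearMap ∘ₗ e.symm.toLinearMap ∘ₗ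
      DirectSum.lof R ι (fun i => X i) i
  have hsum : ∑ i, (b i ∘ₗ a i : Module.End R N) = 1 := by
    refine LinearMap.ext fun x => ?_
    rw [LinearMap.sum_apply]
    simp only [a, b, LinearMap.comp_apply]
    rw [← map_sum, ← map_sum, ← map_sum]
    have hx (y : ⨁ i, X i) : ∑ i, DirectSum.lof R ι (fun i => X i) i
        (DirectSum.component R ι (fun i => X i) i y) = y :=
      DirectSum.sum_univ_of y
    rw [hx]
    simp
  obtain ⟨i, -, hi⟩ := exists_isUnit_of_isUnit_sum Finset.univ (fun i => (b i ∘ₗ a i :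
    Module.End R N)) (by rw [hsum]; exact isUnit_one)
  obtain ⟨c, hc⟩ := hi.exists_left_inv
  exact ⟨i, (hX i).nonempty_equiv_of_retract (f := a i) (g := c ∘ₗ b i) hc⟩

open scoped DirectSum in
theorem addSpan_le_of_equiv_directSum [IsArtinianRing R] {ι : Type*} [Finite ι]
    {X : ι → FGModuleCat.{u} R} (hX : ∀ i, IsIndecomposable (X i)) {M : FGModuleCat.{u} R}
    (e : M ≃ₗ[R] ⨁ i, X i) :
    addSpan M ≤ AddSubgroup.closure (Set.range fun i => K0.cls (X i)) := by
  rw [addSpan, AddSubgroup.closure_le]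
  rintro _ ⟨N, hN, hNM, rfl⟩
  obtain ⟨i, ⟨e'⟩⟩ := exists_equiv_of_isSummand_directSum hX e hN hNM
  exact AddSubgroup.subset_closure ⟨i, K0.cls_congr e'⟩

open scoped DirectSum in
theorem cls_mem_addSpan_of_equiv_directSum [IsArtinianRing R] {ι : Type*}
    {X : ι → FGModuleCat.{u} R}
    {M : FGModuleCat.{u} R} (e : M ≃ₗ[R] ⨁ i, X i) {i : ι} (hX : IsIndecomposable (X i)) :
    K0.cls (X i) ∈ addSpan M := by
  classical
  refine AddSubgroup.subset_closure ⟨X i, hX, ?_, rfl⟩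
  refine isSummand_of_retract (f := e.symm.toLinearMap ∘ₗ DirectSum.lof R ι (fun i => X i) i)
    (g := DirectSum.component R ι (fun i => X i) i ∘ₗ e.toLinearMap) (LinearMap.ext fun x => ?_)
  simp only [LinearMap.comp_apply, LinearEquiv.coe_coe, LinearEquiv.apply_symm_apply,
    LinearMap.id_apply]
  exact DirectSum.component.lof_self R (M := fun i => X i) i x

theorem cls_pi_mem {n : ℕ} (H : AddSubgroup (K0 R)) (X : Fin n → Type u)
    [∀ i, AddCommGroup (X i)] [∀ i, Module R (X i)] [∀ i, Module.Finite R (X i)]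
    (h : ∀ i, K0.cls (FGModuleCat.of R (X i)) ∈ H) :
    K0.cls (FGModuleCat.of R ((i : Fin n) → X i)) ∈ H := by
  induction n with
  | zero =>
    rw [K0.cls_projective]
    · exact H.zero_mem
    · exact inferInstanceAs (Module.Projective R ((i : Fin 0) → X i))
  | succ n ih =>
    rw [K0.cls_prod (M := FGModuleCat.of R ((i : Fin (n + 1)) → X i))
      (M' := FGModuleCat.of R (X 0)) (M'' := FGModuleCat.of R ((i : Fin n) → X i.succ))
      (Fin.consLinearEquiv R X).symm]
    exact H.add_mem (h 0) (ih _ fun i => h i.succ)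

/-! ### Bounding the Igusa-Todorov function -/

variable [IsArtinianRing R]

/-- If `⟨add M⟩` is finitely generated, then `φ(M)` has its defining property: the kernels of the
powers of `Ω̄` on `⟨add M⟩` form an ascending chain of subgroups of a noetherian group. -/
theorem injOn_phi {M : FGModuleCat.{u} R} (hM : (addSpan M).FG) (s : ℕ) :
    Set.InjOn (omegaBar R) ((omegaBar R)^[phi M + s] '' (addSpan M : Set (K0 R))) := by
  have hiter (n : ℕ) (x : K0 R) : (omegaBar R)^[n] x = ((omegaBar R).toIntLinearMap ^ n) x :=
    (Module.End.pow_apply (omegaBar R).toIntLinearMap n x).symm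
  let H : Submodule ℤ (K0 R) := AddSubgroup.toIntSubmodule (addSpan M)
  have : Module.Finite ℤ H := Module.Finite.iff_fg.mpr
    ((Submodule.fg_iff_addSubgroup_fg H).mpr hM)
  have hmono : Monotone fun n : ℕ =>
      LinearMap.ker (((omegaBar R).toIntLinearMap ^ n) ∘ₗ H.subtype) := by
    refine monotone_nat_of_le_succ fun n x hx => ?_
    rw [LinearMap.mem_ker, LinearMap.comp_apply] at hx ⊢
    rw [pow_succ', Module.End.mul_apply, hx, map_zero]
  obtain ⟨l, hl⟩ := monotone_stabilizes_iff_noetherian.mpr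
    (inferInstanceAs (IsNoetherian ℤ H)) ⟨_, hmono⟩
  refine Nat.sInf_mem (s := {l : ℕ | ∀ s : ℕ, Set.InjOn (omegaBar R)
    ((omegaBar R)^[l + s] '' (addSpan M : Set (K0 R)))}) ⟨l, fun s => ?_⟩ s
  rintro _ ⟨x, hx, rfl⟩ _ ⟨y, hy, rfl⟩ hxy
  have hmem : (⟨x - y, (addSpan M).sub_mem hx hy⟩ : H) ∈
      LinearMap.ker (((omegaBar R).toIntLinearMap ^ (l + s + 1)) ∘ₗ H.subtype) := by
    rw [← Function.iterate_succ_apply' (omegaBar R), ← Function.iterate_succ_apply' (omegaBar R),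
      hiter, hiter] at hxy
    rw [LinearMap.mem_ker, LinearMap.comp_apply]
    exact (map_sub _ _ _).trans (sub_eq_zero.mpr hxy)
  have h1 := hl (l + s) (by omega)
  have h2 := hl (l + s + 1) (by omega)
  have h3 : (⟨x - y, (addSpan M).sub_mem hx hy⟩ : H) ∈
      LinearMap.ker (((omegaBar R).toIntLinearMap ^ (l + s)) ∘ₗ H.subtype) := by
    change _ ∈ (OrderHom.mk _ hmono : ℕ →o Submodule ℤ H) (l + s)
    rw [← h1, h2]
    exact hmem
  rw [hiter, hiter]
  rw [LinearMap.mem_ker, LinearMap.comp_apply] at h3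
  exact sub_eq_zero.mp ((map_sub _ _ _).symm.trans h3)

/-- If the `d`-th syzygies of all modules lie in `⟨add S⟩`, then `φ` exceeds `φ(S)` by at most
`d`. -/
theorem phiDim_le_phi_add {S : FGModuleCat.{u} R} (hS : (addSpan S).FG) (d : ℕ)
    (h : ∀ x : K0 R, (omegaBar R)^[d] x ∈ addSpan S) : phiDim R ≤ (phi S : ℕ∞) + d := by
  refine iSup_le fun M => ?_
  rw [← Nat.cast_add, Nat.cast_le]
  refine Nat.sInf_le fun s => (injOn_phi hS s).mono ?_
  rintro _ ⟨x, -, rfl⟩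
  refine ⟨(omegaBar R)^[d] x, h x, ?_⟩
  rw [← Function.iterate_add_apply, Nat.add_right_comm]

theorem iterate_omegaBar_mem_of_cls (H : AddSubgroup (K0 R)) (d : ℕ)
    (h : ∀ M : FGModuleCat.{u} R, (omegaBar R)^[d] (K0.cls M) ∈ H) (x : K0 R) :
    (omegaBar R)^[d] x ∈ H := by
  obtain ⟨x, rfl⟩ := QuotientAddGroup.mk'_surjective _ x
  induction x using FreeAbelianGroup.induction_on with
  | zero => rw [map_zero, iterate_map_zero]; exact H.zero_mem
  | of M => exact h M
  | neg M ih => rw [map_neg, iterate_map_neg]; exact H.neg_mem ih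
  | add x y hx hy => rw [map_add, iterate_map_add]; exact H.add_mem hx hy

end IgusaTodorov

namespace PathAlgebra

open IgusaTodorov

variable {k : Type u} {V : Type v} [Field k] [Quiver.{w} V] [Fintype V]
  {I : TwoSidedIdeal (PathAlgebra k V)}

/-! ### Second syzygies over a monomial algebra -/

/-- The algebra `A = kQ / I`, as a right module over itself, is the free module of rank one over
the opposite algebra. -/
def opEquiv (I : TwoSidedIdeal (PathAlgebra k V)) :
    QuotAlg I ≃ₗ[(QuotAlg I)ᵐᵒᵖ] (QuotAlg I)ᵐᵒᵖ :=
  { MulOpposite.opAddEquiv with map_smul' := fun _ _ => rfl }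

instance : Module.Finite (QuotAlg I)ᵐᵒᵖ (QuotAlg I) := Module.Finite.equiv (opEquiv I).symm

theorem projective_fin_fun (n : ℕ) : Module.Projective (QuotAlg I)ᵐᵒᵖ (Fin n → QuotAlg I) :=
  Module.Projective.of_equiv (LinearEquiv.piCongrRight fun _ => (opEquiv I).symm)

theorem exists_fin_surjective (M : FGModuleCat.{max u v w} (QuotAlg I)ᵐᵒᵖ) :
    ∃ (n : ℕ) (f : (Fin n → QuotAlg I) →ₗ[(QuotAlg I)ᵐᵒᵖ] M), Function.Surjective f := by
  obtain ⟨n, f, hf⟩ := Module.Finite.exists_fin' (QuotAlg I)ᵐᵒᵖ M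
  exact ⟨n, f ∘ₗ (LinearEquiv.piCongrRight fun _ => opEquiv I).toLinearMap,
    hf.comp (LinearEquiv.piCongrRight fun _ => opEquiv I).surjective⟩

variable [∀ a b : V, Finite (a ⟶ b)] [IsAdmissible I]

/-- The right ideal `ρ A` as an object of the category of finitely generated right modules. -/
abbrev pathModule (I : TwoSidedIdeal (PathAlgebra k V)) [IsAdmissible I] (p : QPath V) :
    FGModuleCat.{max u v w} (QuotAlg I)ᵐᵒᵖ :=
  FGModuleCat.of (QuotAlg I)ᵐᵒᵖ (pathIdeal I p)

/-- The second syzygy of any module is, up to projective summands, the kernel of a map between free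
modules. -/
theorem exists_omegaBar_omegaBar_cls_eq (M : FGModuleCat.{max u v w} (QuotAlg I)ᵐᵒᵖ) :
    ∃ (m n : ℕ) (g : (Fin m → QuotAlg I) →ₗ[(QuotAlg I)ᵐᵒᵖ] (Fin n → QuotAlg I)),
      omegaBar _ (omegaBar _ (K0.cls M)) =
        K0.cls (FGModuleCat.of (QuotAlg I)ᵐᵒᵖ (LinearMap.ker g)) := by
  obtain ⟨n, f, hf⟩ := exists_fin_surjective M
  obtain ⟨m, f', hf'⟩ := exists_fin_surjective
    (FGModuleCat.of (QuotAlg I)ᵐᵒᵖ (LinearMap.ker f))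
  refine ⟨m, n, (LinearMap.ker f).subtype ∘ₗ f', ?_⟩
  rw [omegaBar_cls, cls_syzygy_eq (P := FGModuleCat.of (QuotAlg I)ᵐᵒᵖ (Fin n → QuotAlg I)) f
    (projective_fin_fun n) hf, omegaBar_cls,
    cls_syzygy_eq (P := FGModuleCat.of (QuotAlg I)ᵐᵒᵖ (Fin m → QuotAlg I)) f'
    (projective_fin_fun m) hf']
  exact K0.cls_congr (M := FGModuleCat.of (QuotAlg I)ᵐᵒᵖ (LinearMap.ker f'))
    (LinearEquiv.ofEq _ _ (LinearMap.ker_comp_of_ker_eq_bot _ (Submodule.ker_subtype _)).symm)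

/-- The defining decomposition of `sumPathIdeals I`. -/
def sumPathIdealsEquiv (I : TwoSidedIdeal (PathAlgebra k V)) [IsAdmissible I] :
    sumPathIdeals I ≃ₗ[(QuotAlg I)ᵐᵒᵖ] DirectSum (NonzeroPath I) fun p => pathModule I p.1 :=
  LinearEquiv.refl _ _

/-- Trivial paths generate projective ideals, of class zero; the ideals of the longer paths are
indecomposable summands of `sumPathIdeals I`. -/
theorem cls_pathModule_mem_addSpan (hI : IsMonomial I) {σ : QPath V} (hσ : pathClass I σ ≠ 0) :
    K0.cls (pathModule I σ) ∈ addSpan (sumPathIdeals I) := by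
  by_cases h : 1 ≤ σ.length
  · exact cls_mem_addSpan_of_equiv_directSum (X := fun p : NonzeroPath I => pathModule I p.1)
      (sumPathIdealsEquiv I) (i := ⟨σ, h, hσ⟩) (isIndecomposable_pathIdeal hI hσ)
  · rw [QPath.IsComp.eq_trivial_of_length_eq_zero (p := σ) (by omega),
      K0.cls_projective _ (projective_pathIdeal_trivial _)]
    exact AddSubgroup.zero_mem _

theorem addSpan_sumPathIdeals_fg (hI : IsMonomial I) : (addSpan (sumPathIdeals I)).FG := by
  have heq : addSpan (sumPathIdeals I) =
      AddSubgroup.closure (Set.range fun p : NonzeroPath I => K0.cls (pathModule I p.1)) := by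
    apply le_antisymm
    · exact addSpan_le_of_equiv_directSum (fun p => isIndecomposable_pathIdeal hI p.2.2)
        (sumPathIdealsEquiv I)
    · rw [AddSubgroup.closure_le]
      rintro _ ⟨p, rfl⟩
      exact cls_pathModule_mem_addSpan hI p.2.2
  exact (AddSubgroup.fg_iff _).mpr ⟨_, heq.symm, Set.finite_range _⟩

theorem omegaBar_iterate_two_mem_addSpan (hI : IsMonomial I) (x : K0 (QuotAlg I)ᵐᵒᵖ) :
    (omegaBar (QuotAlg I)ᵐᵒᵖ)^[2] x ∈ addSpan (sumPathIdeals I) := by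
  refine iterate_omegaBar_mem_of_cls _ 2 (fun M => ?_) x
  obtain ⟨m, n, g, hg⟩ := exists_omegaBar_omegaBar_cls_eq M
  obtain ⟨ι, _, σ, hσ, ⟨e⟩⟩ := exists_ker_equiv_pi_pathIdeal hI g
  let c := Fintype.equivFin ι
  have e' := e.trans (LinearEquiv.piCongrLeft' (QuotAlg I)ᵐᵒᵖ (fun i => pathIdeal I (σ i)) c)
  change omegaBar _ (omegaBar _ (K0.cls M)) ∈ _
  rw [hg, K0.cls_congr (N := FGModuleCat.of (QuotAlg I)ᵐᵒᵖ
    ((i : Fin (Fintype.card ι)) → pathIdeal I (σ (c.symm i)))) e']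
  exact cls_pi_mem _ _ fun i => cls_pathModule_mem_addSpan hI (hσ _)

end PathAlgebra

theorem mainTheorem6 {k : Type u} {V : Type v} [Field k] [Quiver.{w} V] [Fintype V]
    [∀ a b : V, Finite (a ⟶ b)] (I : TwoSidedIdeal (PathAlgebra k V))
    [PathAlgebra.IsAdmissible I] (hI : PathAlgebra.IsMonomial I) :
    (IgusaTodorov.phi (PathAlgebra.sumPathIdeals I) : ℕ∞) ≤
        IgusaTodorov.phiDim (PathAlgebra.QuotAlg I)ᵐᵒᵖ ∧
      IgusaTodorov.phiDim (PathAlgebra.QuotAlg I)ᵐᵒᵖ ≤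
        (IgusaTodorov.phi (PathAlgebra.sumPathIdeals I) : ℕ∞) + 2 :=
  ⟨le_iSup (fun M => (IgusaTodorov.phi M : ℕ∞)) (PathAlgebra.sumPathIdeals I),
    IgusaTodorov.phiDim_le_phi_add (PathAlgebra.addSpan_sumPathIdeals_fg hI) 2
      (PathAlgebra.omegaBar_iterate_two_mem_addSpan hI)⟩

end
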